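/- Let $n\ge 2$. On $(\mathbb C\setminus\{0\})^n$ with coordinates $p=(p_1,\dots,p_n)$ consider the cometric $$g^{ij}(p)=\frac{1-\delta^{ij}}{p_ip_j},\qquad 1\le i,j\le n,$$ and let $u_i=e_i(p_1^2,\dots,p_n^2)$, $i=1,\dots,n$, where $e_i$ is the $i$-th elementary symmetric polynomial; $u_1,\dots,u_n$ are the basic invariants of the group $B_n$ of signed permutations and serve as coordinates on the orbit space $\mathbb C^n/B_n\cong\mathbb C^n$. Conventions. Let $\Omega\subseteq\mathbb C^n$ be open. A (contravariant) metric on $\Omega$ is a symmetric matrix $(G^{ij})$ of holomorphic functions on $\Omega$ whose determinant is nonzero on a dense subset of $\Omega$. Where $\det G\ne0$, let $(G_{ij})=(G^{ij})^{-1}$, let $\Gamma^k_{ij}=\frac12\sum_m G^{mk}(\partial_jG_{im}+\partial_iG_{jm}-\partial_mG_{ij})$ be the Christoffel symbols of its Levi-Civita connection and $\Gamma^{ij}_k=-\sum_s G^{is}\Gamma^j_{sk}$ its contravariant Christoffel symbols. The metric is flat if its Riemann tensor vanishes wherever $\det G\neq0$. Two metrics $(G_1,G_2)$ form a flat pencil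 if for every $\lambda\in\mathbb C$ the matrix $G_1+\lambda G_2$ is a flat metric, and there are functions $\Gamma^{ij}_{1\,k},\Gamma^{ij}_{2\,k}$ on $\Omega$, equal to the contravariant Christoffel symbols of $G_1$ and $G_2$ wherever these metrics are nondegenerate, such that for every $\lambda$ the contravariant Christoffel symbols of $G_1+\lambda G_2$ are $\Gamma^{ij}_{1\,k}+\lambda\Gamma^{ij}_{2\,k}$ wherever $G_1+\lambda G_2$ is nondegenerate. Theorem. The cometric $g^{ij}(p)$ is $B_n$-invariant, nondegenerate at every point of $(\mathbb C\setminus\{0\})^n$, and flat. There are polynomials $g^{ij}(u)\in\mathbb C[u_1,\dots,u_n]$ with $$g^{ij}(u(p))=\sum_{k,l=1}^n g^{kl}(p)\,\frac{\partial u_i}{\partial p_k}\frac{\partial u_j}{\partial p_l}\qquad\text{for all } p\in(\mathbb C\setminus\{0\})^n,$$ such that: 1. each $g^{ij}(u)$ has degree at most one in $u_{n-1}$, and $(g^{ij}(u))$ is a flat metric on $\mathbb C^n$; 2. the contravariant Christoffel symbols $\Gamma^{ij}_k(u)$ of $(g^{ij}(u))$ are, wherever the metric is nondegenerate, given by polynomials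 in $u_1,\dots,u_n$ of degree at most one in $u_{n-1}$; 3. $\eta^{ij}(u):=\dfrac{\partial g^{ij}}{\partial u_{n-1}}(u)$ has constant nonzero determinant, and the pair $(g,\eta)$ forms a flat pencil of metrics on $\mathbb C^n$. -/

import Mathlib

open MvPolynomial

noncomputable section

/-- A field of `n × n` matrices on the coordinate space `ℂⁿ` (the components of a contravariant
2-tensor in a fixed coordinate system). -/
abbrev CometricField (n : ℕ) := (Fin n → ℂ) → Matrix (Fin n) (Fin n) ℂ

/-- The holomorphic partial derivative `∂f/∂x_k` at `x`. -/
def coordDeriv {n : ℕ} (k : Fin n) (f : (Fin n → ℂ) → ℂ) (x : Fin n → ℂ) : ℂ :=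
  fderiv ℂ f x (Pi.single k 1)

/-- The covariant components `g_{ij}` of the metric with contravariant components `g^{ij} = G`:
the inverse matrix. Only meaningful where `det G ≠ 0`. -/
def lowerMetric {n : ℕ} (G : CometricField n) (i j : Fin n) (x : Fin n → ℂ) : ℂ :=
  (G x)⁻¹ i j

/-- The Christoffel symbols of the Levi-Civita connection, `christoffel G k i j` being
`Γ^k_{ij} = ½ ∑_m g^{mk} (∂_j g_{im} + ∂_i g_{jm} - ∂_m g_{ij})`. -/
def christoffel {n : ℕ} (G : CometricField n) (k i j : Fin n) (x : Fin n → ℂ) : ℂ :=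
  (1 / 2 : ℂ) * ∑ m : Fin n, G x m k *
    (coordDeriv j (lowerMetric G i m) x + coordDeriv i (lowerMetric G j m) x
      - coordDeriv m (lowerMetric G i j) x)

/-- The contravariant Christoffel symbols `Γ^{ij}_k = - ∑_s g^{is} Γ^j_{sk}`. -/
def contraChristoffel {n : ℕ} (G : CometricField n) (i j k : Fin n) (x : Fin n → ℂ) : ℂ :=
  - ∑ s : Fin n, G x i s * christoffel G j s k x

/-- The Riemann tensor of the Levi-Civita connection,
`R^i_{jkl} = ∂_k Γ^i_{lj} - ∂_l Γ^i_{kj} + ∑_m (Γ^i_{km} Γ^m_{lj} - Γ^i_{lm} Γ^m_{kj})`. -/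
def riemannTensor {n : ℕ} (G : CometricField n) (i j k l : Fin n) (x : Fin n → ℂ) : ℂ :=
  coordDeriv k (christoffel G i l j) x - coordDeriv l (christoffel G i k j) x
    + ∑ m : Fin n, (christoffel G i k m x * christoffel G m l j x
        - christoffel G i l m x * christoffel G m k j x)

/-- `G` is a (contravariant, holomorphic) metric on the open set `Ω`: symmetric, with holomorphic
components, and nondegenerate on a dense subset of `Ω`. (In a pencil `g + t η` nondegeneracy
at every point and for every `t` is impossible over `ℂ` when `η` is nondegenerate.) -/
structure IsMetricOn {n : ℕ} (G : CometricField n) (Ω : Set (Fin n → ℂ)) : Prop where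
  isOpen : IsOpen Ω
  symm : ∀ x ∈ Ω, (G x).IsSymm
  holomorphic : ∀ i j, DifferentiableOn ℂ (fun x => G x i j) Ω
  nondegenerate : Ω ⊆ closure {x | x ∈ Ω ∧ (G x).det ≠ 0}

/-- A metric is flat if its Riemann tensor vanishes wherever the metric is nondegenerate. -/
structure IsFlatMetricOn {n : ℕ} (G : CometricField n) (Ω : Set (Fin n → ℂ)) : Prop
    extends IsMetricOn G Ω where
  flat : ∀ x ∈ Ω, (G x).det ≠ 0 → ∀ i j k l, riemannTensor G i j k l x = 0

/-- The metrics `G₁`, `G₂` form a flat pencil: `G₁ + t G₂` is a flat metric for every `t`, and its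
contravariant Christoffel symbols are `Γ₁ + t Γ₂` for every `t`, where `Γ₁`, `Γ₂` are the
contravariant Christoffel symbols of `G₁` and `G₂`. -/
structure IsFlatPencilOn {n : ℕ} (G₁ G₂ : CometricField n) (Ω : Set (Fin n → ℂ)) : Prop where
  metric₁ : IsMetricOn G₁ Ω
  metric₂ : IsMetricOn G₂ Ω
  flat : ∀ t : ℂ, IsFlatMetricOn (fun x => G₁ x + t • G₂ x) Ω
  christoffel_linear : ∃ Γ₁ Γ₂ : Fin n → Fin n → Fin n → (Fin n → ℂ) → ℂ,
    (∀ x ∈ Ω, (G₁ x).det ≠ 0 → ∀ i j k, contraChristoffel G₁ i j k x = Γ₁ i j k x) ∧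
    (∀ x ∈ Ω, (G₂ x).det ≠ 0 → ∀ i j k, contraChristoffel G₂ i j k x = Γ₂ i j k x) ∧
    ∀ t : ℂ, ∀ x ∈ Ω, (G₁ x + t • G₂ x).det ≠ 0 → ∀ i j k,
      contraChristoffel (fun y => G₁ y + t • G₂ y) i j k x = Γ₁ i j k x + t * Γ₂ i j k x

/-- The complement of the coordinate hyperplanes, where the cometric is defined. -/
def coordTorus (n : ℕ) : Set (Fin n → ℂ) := {p | ∀ i, p i ≠ 0}

/-- The cometric `g^{ij}(p) = (1 - δ^{ij}) / (p_i p_j)`. -/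
def bnCometric (n : ℕ) : CometricField n := fun p =>
  Matrix.of fun i j => (1 - (if i = j then 1 else 0)) / (p i * p j)

/-- The group `B_n`: the signed permutation matrices, acting on `ℂⁿ` by matrix multiplication. -/
def signedPermMatrices (n : ℕ) : Set (Matrix (Fin n) (Fin n) ℂ) :=
  {A | ∃ (σ : Equiv.Perm (Fin n)) (ε : Fin n → ℤˣ),
    A = Matrix.of fun i j => if j = σ i then ((ε i : ℤ) : ℂ) else 0}

/-- The basic invariants `u_{i+1} = e_{i+1}(p_1², …, p_n²)` as polynomials in `p`
(the index `i : Fin n` starts from `0`). -/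
def basicInvariant (n : ℕ) (i : Fin n) : MvPolynomial (Fin n) ℂ :=
  aeval (fun k : Fin n => (X k : MvPolynomial (Fin n) ℂ) ^ 2) (esymm (Fin n) ℂ (i.val + 1))

/-- The point `(u_1(p), …, u_n(p))`. -/
def invariantMap (n : ℕ) (p : Fin n → ℂ) : Fin n → ℂ := fun i => eval p (basicInvariant n i)

/-- The components `g^{ij}(u) = ∑_{k,l} g^{kl}(p) ∂u_i/∂p_k ∂u_j/∂p_l` of the cometric in the
coordinates `u`, as functions of `p`. -/
def bnCometricInInvariants (n : ℕ) (p : Fin n → ℂ) (i j : Fin n) : ℂ :=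
  ∑ k : Fin n, ∑ l : Fin n, bnCometric n p k l *
    eval p (pderiv k (basicInvariant n i)) * eval p (pderiv l (basicInvariant n j))

/-- The matrix field given by a matrix of polynomials in the coordinates. -/
def polyField {n : ℕ} (P : Matrix (Fin n) (Fin n) (MvPolynomial (Fin n) ℂ)) : CometricField n :=
  fun x => P.map (eval x)

/-- The (zero-based) index of the coordinate `u_{n-1}`. -/
def penultimate (n : ℕ) (hn : 2 ≤ n) : Fin n := ⟨n - 2, by omega⟩

/-- The matrix `∂P/∂u_{n-1}`. -/
def derivPenultimate {n : ℕ} (hn : 2 ≤ n) (P : Matrix (Fin n) (Fin n) (MvPolynomial (Fin n) ℂ)) :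
    Matrix (Fin n) (Fin n) (MvPolynomial (Fin n) ℂ) :=
  P.map (pderiv (penultimate n hn))

end

/-! In the coordinates $x_a = p_a^2$ the cometric is the constant matrix $4(1-\delta^{ab})$, which
explains flatness, and $u_i = e_i(x)$. Write $\langle\cdot,\cdot\rangle$ for this constant form.
Then $g^{ij}(u) = \langle de_i, de_j\rangle$, and the contravariant Christoffel symbols are
determined by $\sum_k \Gamma^{ij}_k\,\partial_c e_k = \langle de_i, \partial_c\, de_j\rangle$.

Everything about $e_k$ comes from $\partial_a e_{k+1} = e_k - x_a\,\partial_a e_k$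
(`pderiv_esymm_succ`). It gives an exchange rule that lowers one index of a product and raises the
other. The rule yields a closed formula for $g^{ij}(u)$, in which the only possible square of
$u_{n-1}$ has coefficient zero (`degreeOf_invariantMetric_le`). It also yields polynomial
$\Gamma^{ij}_k(u)$ of degree at most one in every $u_m$ (`isGradComb_flatCometric`).

Since $g$ is affine in $u_{n-1}$, the metric $g + t\eta$ is $g$ translated by $t$ along $u_{n-1}$.
It is therefore flat, and its Christoffel symbols are $\Gamma + t\,\partial\Gamma/\partial u_{n-1}$.
The matrix $\eta$ is triangular about the antidiagonal, with $4(n-1)$ on it; this gives the constant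
determinant, and hence density of the nondegenerate points of each $g + t\eta$.

No inverse coordinate change is made. Metric compatibility, torsion-freeness and flatness are
written as equations between contravariant quantities, without inverse matrices. They become
polynomial identities, checked after substituting $u = e(x)$. This loses nothing, because the $e_k$
are algebraically independent (`esymmHom_injective`) and their differentials are linearly
independent (`esymmGrad_linearIndependent`). The section on connections returns from these equations
to the Levi-Civita connection and the Riemann tensor. -/

/-! ### Christoffel symbols and curvature from the contravariant connection -/

section Connection

variable {n : ℕ}

/-- The matrix of `k`-th partial derivatives of the components of `G`. -/
noncomputable def matrixDeriv (k : Fin n) (G : CometricField n) (x : Fin n → ℂ) :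
    Matrix (Fin n) (Fin n) ℂ :=
  Matrix.of fun i j => coordDeriv k (fun y => G y i j) x

/-- `C` satisfies at `x` the equations which characterise the contravariant Christoffel symbols
of `G`: compatibility with the metric and vanishing torsion. -/
structure IsLeviCivitaAt (G : CometricField n) (C : Fin n → CometricField n)
    (x : Fin n → ℂ) : Prop where
  differentiable : ∀ i j, DifferentiableAt ℂ (fun y => G y i j) x
  symm : (G x).IsSymm
  compat : ∀ k, matrixDeriv k G x = C k x + (C k x).transpose
  torsion : ∀ i j k, ∑ s, G x i s * C s x j k = ∑ s, G x j s * C s x i k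

/-- The connection `C` on the metric `G` has no curvature at `x`. -/
structure IsFlatConnectionAt (G : CometricField n) (C : Fin n → CometricField n)
    (x : Fin n → ℂ) : Prop where
  differentiable : ∀ k i j, DifferentiableAt ℂ (fun y => C k y i j) x
  curvature : ∀ i j k l, ∑ s, G x i s * (matrixDeriv s (C l) x j k - matrixDeriv l (C s) x j k) =
    ∑ s, (C s x i j * C l x s k - C s x i k * C l x s j)

theorem differentiableAt_det {A : CometricField n} {x : Fin n → ℂ}
    (hA : ∀ i j, DifferentiableAt ℂ (fun y => A y i j) x) :
    DifferentiableAt ℂ (fun y => (A y).det) x := by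
  simp only [Matrix.det_apply]
  refine DifferentiableAt.fun_sum fun σ _ => ?_
  have h : DifferentiableAt ℂ (fun y => ∏ i, A y (σ i) i) x := by
    exact (HasFDerivAt.finsetProd fun i _ => (hA (σ i) i).hasFDerivAt).differentiableAt
  exact h.const_smul _

theorem differentiableAt_lowerMetric {G : CometricField n} {x : Fin n → ℂ}
    (hG : ∀ i j, DifferentiableAt ℂ (fun y => G y i j) x) (hdet : (G x).det ≠ 0) (i j : Fin n) :
    DifferentiableAt ℂ (lowerMetric G i j) x := by
  have h : lowerMetric G i j = fun y => (G y).det⁻¹ * (G y).adjugate i j := by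
    funext y
    simp [lowerMetric, Matrix.inv_def]
  rw [h]
  refine ((differentiableAt_det hG).inv hdet).mul ?_
  simp only [Matrix.adjugate_apply]
  refine differentiableAt_det (A := fun y => (G y).updateRow j (Pi.single i 1)) fun a b => ?_
  by_cases ha : a = j
  · subst ha
    simp
  · simpa [Matrix.updateRow_ne ha] using hG a b

theorem coordDeriv_congr {f g : (Fin n → ℂ) → ℂ} {x : Fin n → ℂ} (h : f =ᶠ[nhds x] g)
    (k : Fin n) : coordDeriv k f x = coordDeriv k g x := by
  rw [coordDeriv, coordDeriv, h.fderiv_eq]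

theorem coordDeriv_const (k : Fin n) (c : ℂ) (x : Fin n → ℂ) :
    coordDeriv k (fun _ => c) x = 0 := by
  simp [coordDeriv]

theorem coordDeriv_neg (k : Fin n) (f : (Fin n → ℂ) → ℂ) (x : Fin n → ℂ) :
    coordDeriv k (fun y => -f y) x = -coordDeriv k f x := by
  simp [coordDeriv]

theorem coordDeriv_mul {f g : (Fin n → ℂ) → ℂ} {x : Fin n → ℂ} (k : Fin n)
    (hf : DifferentiableAt ℂ f x) (hg : DifferentiableAt ℂ g x) :
    coordDeriv k (fun y => f y * g y) x = coordDeriv k f x * g x + f x * coordDeriv k g x := by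
  simp only [coordDeriv, fderiv_fun_mul hf hg, _root_.add_apply,
    _root_.smul_apply, smul_eq_mul]
  ring

theorem matrixDeriv_mul {A B : CometricField n} {x : Fin n → ℂ} (k : Fin n)
    (hA : ∀ i j, DifferentiableAt ℂ (fun y => A y i j) x)
    (hB : ∀ i j, DifferentiableAt ℂ (fun y => B y i j) x) :
    matrixDeriv k (fun y => A y * B y) x = matrixDeriv k A x * B x + A x * matrixDeriv k B x := by
  ext i j
  simp only [matrixDeriv, Matrix.of_apply, Matrix.mul_apply, Matrix.add_apply]
  rw [coordDeriv, fderiv_fun_sum fun a _ => (hA i a).fun_mul (hB a j), _root_.sum_apply,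
    ← Finset.sum_add_distrib]
  exact Finset.sum_congr rfl fun a _ => coordDeriv_mul k (hA i a) (hB a j)

theorem eventually_det_ne_zero {G : CometricField n} {x : Fin n → ℂ}
    (hG : ∀ i j, DifferentiableAt ℂ (fun y => G y i j) x) (hdet : (G x).det ≠ 0) :
    ∀ᶠ y in nhds x, (G y).det ≠ 0 :=
  (differentiableAt_det hG).continuousAt.eventually_ne hdet

theorem matrixDeriv_inv {G : CometricField n} {x : Fin n → ℂ} (k : Fin n)
    (hG : ∀ i j, DifferentiableAt ℂ (fun y => G y i j) x) (hdet : (G x).det ≠ 0) :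
    matrixDeriv k (fun y => (G y)⁻¹) x = -((G x)⁻¹ * matrixDeriv k G x * (G x)⁻¹) := by
  have h1 := matrixDeriv_mul (B := fun y => (G y)⁻¹) k hG (differentiableAt_lowerMetric hG hdet)
  have h2 : matrixDeriv k (fun y => G y * (G y)⁻¹) x = 0 := by
    ext i j
    rw [matrixDeriv, Matrix.of_apply, Matrix.zero_apply,
      ← coordDeriv_const k ((1 : Matrix (Fin n) (Fin n) ℂ) i j) x]
    refine coordDeriv_congr ?_ k
    filter_upwards [eventually_det_ne_zero hG hdet] with y hy
    rw [Matrix.mul_nonsing_inv _ (isUnit_iff_ne_zero.2 hy)]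
  rw [h2] at h1
  have h3 := congrArg ((G x)⁻¹ * ·) h1
  simp only [mul_zero, mul_add, ← mul_assoc,
    Matrix.nonsing_inv_mul _ (isUnit_iff_ne_zero.2 hdet), one_mul] at h3
  rw [eq_neg_iff_add_eq_zero, add_comm]
  exact h3.symm

variable {G : CometricField n} {C : Fin n → CometricField n} {x : Fin n → ℂ}

namespace IsLeviCivitaAt

/-- Lowering the first upper index of $\Gamma^{sj}_k$ gives $-\Gamma^j_{sk}$, so this is the usual
symmetry of a torsion-free connection. For fixed $j$ the torsion equation says that $G U^T$ is
symmetric, and conjugation by $G^{-1}$ transfers this to $G^{-1}U$. -/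
theorem inv_mul_comm (h : IsLeviCivitaAt G C x) (hdet : (G x).det ≠ 0) (k s j : Fin n) :
    ((G x)⁻¹ * C k x) s j = ((G x)⁻¹ * C s x) k j := by
  have hu := isUnit_iff_ne_zero.2 hdet
  have hg : ((G x)⁻¹).transpose = (G x)⁻¹ := by rw [Matrix.transpose_nonsing_inv, h.symm]
  let U : Matrix (Fin n) (Fin n) ℂ := Matrix.of fun s k => C k x s j
  have hU : G x * U.transpose = (G x * U.transpose).transpose := by
    ext a b
    simpa [U, Matrix.mul_apply] using h.torsion a b j
  have key : (G x)⁻¹ * U = ((G x)⁻¹ * U).transpose := by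
    rw [Matrix.transpose_mul, Matrix.transpose_transpose, h.symm] at hU
    calc (G x)⁻¹ * U = (G x)⁻¹ * (U * G x) * (G x)⁻¹ := by
          rw [mul_assoc, mul_assoc, Matrix.mul_nonsing_inv _ hu, mul_one]
      _ = (G x)⁻¹ * (G x * U.transpose) * (G x)⁻¹ := by rw [hU]
      _ = U.transpose * (G x)⁻¹ := by
          rw [← mul_assoc, Matrix.nonsing_inv_mul _ hu, one_mul]
      _ = ((G x)⁻¹ * U).transpose := by rw [Matrix.transpose_mul, hg]
  have := congrFun (congrFun key s) k
  simpa [U, Matrix.mul_apply] using this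

/-- Uniqueness of the Levi-Civita connection, by Koszul's argument. The fully lowered symbols `S`
are symmetric in the differentiation index and the first matrix index, and $\partial_k g_{ab} =
-(S_{kab}+S_{kba})$; four of the six terms in the Christoffel formula cancel. -/
theorem christoffel_eq (h : IsLeviCivitaAt G C x) (hdet : (G x).det ≠ 0) (k i j : Fin n) :
    christoffel G k i j x = -((G x)⁻¹ * C j x) i k := by
  have hu := isUnit_iff_ne_zero.2 hdet
  have hg : ((G x)⁻¹).transpose = (G x)⁻¹ := by rw [Matrix.transpose_nonsing_inv, h.symm]
  set S : Fin n → Matrix (Fin n) (Fin n) ℂ := fun k => (G x)⁻¹ * C k x * (G x)⁻¹ with hS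
  have hsymm : ∀ a b m, S a b m = S b a m := fun a b m => by
    simp only [hS]
    rw [Matrix.mul_apply, Matrix.mul_apply]
    exact Finset.sum_congr rfl fun c _ => by rw [h.inv_mul_comm hdet]
  have hder : ∀ k a b, coordDeriv k (lowerMetric G a b) x = -(S k a b + S k b a) := by
    intro k a b
    have h1 := matrixDeriv_inv k h.differentiable hdet
    rw [h.compat, mul_add, add_mul] at h1
    have h2 : (G x)⁻¹ * (C k x).transpose * (G x)⁻¹ = (S k).transpose := by
      simp only [hS]
      rw [Matrix.transpose_mul, Matrix.transpose_mul, hg, mul_assoc]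
    rw [h2] at h1
    exact congrFun (congrFun h1 a) b
  have h3 : (G x)⁻¹ * C j x = S j * G x := by
    simp only [hS]
    rw [mul_assoc, Matrix.nonsing_inv_mul _ hu, mul_one]
  rw [h3, christoffel, Matrix.mul_apply, Finset.mul_sum, ← Finset.sum_neg_distrib]
  refine Finset.sum_congr rfl fun m _ => ?_
  rw [hder, hder, hder, hsymm m i j, hsymm m j i, hsymm i j m]
  ring

theorem contraChristoffel_eq (h : IsLeviCivitaAt G C x) (hdet : (G x).det ≠ 0) (i j k : Fin n) :
    contraChristoffel G i j k x = C k x i j := by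
  have h1 : C k x i j = (G x * ((G x)⁻¹ * C k x)) i j := by
    rw [← mul_assoc, Matrix.mul_nonsing_inv _ (isUnit_iff_ne_zero.2 hdet), one_mul]
  rw [h1, contraChristoffel, Matrix.mul_apply, ← Finset.sum_neg_distrib]
  refine Finset.sum_congr rfl fun s _ => ?_
  rw [h.christoffel_eq hdet]
  ring

/-- The curvature equation with its index lowered. The difference of the two sides, as a covector in
$k$, is annihilated by $G$: after contraction, torsion moves the free index so that each $G^{-1}$ is
absorbed, leaving exactly that equation. -/
theorem matrixDeriv_sub_eq (h : IsLeviCivitaAt G C x) (hC : IsFlatConnectionAt G C x)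
    (hdet : (G x).det ≠ 0) (k l : Fin n) :
    matrixDeriv k (C l) x - matrixDeriv l (C k) x =
      (C k x).transpose * (G x)⁻¹ * C l x - (C l x).transpose * (G x)⁻¹ * C k x := by
  have hu := isUnit_iff_ne_zero.2 hdet
  rw [← sub_eq_zero]
  ext b i
  set W : Fin n → ℂ := fun k => (matrixDeriv k (C l) x - matrixDeriv l (C k) x -
      ((C k x).transpose * (G x)⁻¹ * C l x - (C l x).transpose * (G x)⁻¹ * C k x)) b i with hW
  suffices hGW : (G x).mulVec W = 0 by
    have : W = 0 := by
      rw [← Matrix.one_mulVec W, ← Matrix.nonsing_inv_mul _ hu, ← Matrix.mulVec_mulVec, hGW,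
        Matrix.mulVec_zero]
    exact congrFun this k
  ext p
  have e1 : ∑ s, G x p s * ((C s x).transpose * (G x)⁻¹ * C l x) b i =
      ∑ s, C s x p b * C l x s i := by
    have : ∀ s, ((C s x).transpose * (G x)⁻¹ * C l x) b i =
        ∑ a, C s x a b * ((G x)⁻¹ * C l x) a i := fun s => by
      rw [mul_assoc, Matrix.mul_apply]; rfl
    simp only [this, Finset.mul_sum]
    rw [Finset.sum_comm]
    have h2 : ∀ a, ∑ s, G x p s * (C s x a b * ((G x)⁻¹ * C l x) a i) =
        ∑ s, G x a s * (C s x p b * ((G x)⁻¹ * C l x) a i) := fun a => by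
      simp only [← mul_assoc, ← Finset.sum_mul]
      rw [h.torsion]
    rw [Finset.sum_congr rfl fun a _ => h2 a, Finset.sum_comm]
    refine Finset.sum_congr rfl fun s _ => ?_
    have h3 : C l x s i = (G x * ((G x)⁻¹ * C l x)) s i := by
      rw [← mul_assoc, Matrix.mul_nonsing_inv _ hu, one_mul]
    rw [h3, Matrix.mul_apply, Finset.mul_sum]
    refine Finset.sum_congr rfl fun a _ => ?_
    rw [h.symm.apply s a]
    ring
  have e2 : ∑ s, G x p s * ((C l x).transpose * (G x)⁻¹ * C s x) b i =
      ∑ s, C s x p i * C l x s b := by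
    have : ∀ s, ((C l x).transpose * (G x)⁻¹ * C s x) b i =
        ∑ a, C l x a b * ((G x)⁻¹ * C a x) s i := fun s => by
      rw [mul_assoc, Matrix.mul_apply]
      exact Finset.sum_congr rfl fun a _ => by rw [h.inv_mul_comm hdet]; rfl
    simp only [this, Finset.mul_sum]
    rw [Finset.sum_comm]
    refine Finset.sum_congr rfl fun a _ => ?_
    have h3 : C a x p i = (G x * ((G x)⁻¹ * C a x)) p i := by
      rw [← mul_assoc, Matrix.mul_nonsing_inv _ hu, one_mul]
    rw [h3, Matrix.mul_apply, Finset.sum_mul]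
    exact Finset.sum_congr rfl fun s _ => by ring
  have e3 := hC.curvature p b i l
  rw [Finset.sum_sub_distrib] at e3
  simp only [Matrix.mulVec, dotProduct, hW, Matrix.sub_apply, mul_sub, Finset.sum_sub_distrib,
    Pi.zero_apply] at e3 ⊢
  rw [e1, e2, e3]
  ring

theorem riemannTensor_eq_zero (h : ∀ᶠ y in nhds x, IsLeviCivitaAt G C y)
    (hC : IsFlatConnectionAt G C x) (hdet : (G x).det ≠ 0) (i j k l : Fin n) :
    riemannTensor G i j k l x = 0 := by
  have hx := h.self_of_nhds
  have hB : ∀ l, ∀ᶠ y in nhds x, christoffel G i l j y = -((G y)⁻¹ * C l y) j i := by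
    intro l
    filter_upwards [h, eventually_det_ne_zero hx.differentiable hdet] with y hy hd
    rw [hy.christoffel_eq hd, hy.inv_mul_comm hd]
  have hd : ∀ k l, coordDeriv k (christoffel G i l j) x =
      -(-((G x)⁻¹ * (C k x + (C k x).transpose) * (G x)⁻¹) * C l x +
        (G x)⁻¹ * matrixDeriv k (C l) x) j i := by
    intro k l
    rw [coordDeriv_congr (hB l), coordDeriv_neg, ← hx.compat k,
      ← matrixDeriv_inv k hx.differentiable hdet]
    rw [← matrixDeriv_mul (A := fun y => (G y)⁻¹) k
      (differentiableAt_lowerMetric hx.differentiable hdet) (hC.differentiable l)]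
    rfl
  have hq : ∀ k l, ∑ m, christoffel G i k m x * christoffel G m l j x =
      ((G x)⁻¹ * C l x * ((G x)⁻¹ * C k x)) j i := by
    intro k l
    rw [Matrix.mul_apply]
    refine Finset.sum_congr rfl fun m _ => ?_
    rw [hx.christoffel_eq hdet, hx.christoffel_eq hdet, hx.inv_mul_comm hdet m k,
      hx.inv_mul_comm hdet j l]
    ring
  rw [riemannTensor, Finset.sum_sub_distrib, hq, hq, hd, hd]
  have key := congrArg ((G x)⁻¹ * ·) (hx.matrixDeriv_sub_eq hC hdet k l)
  have key2 := congrFun (congrFun key j) i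
  -- As matrices, the Riemann tensor is $G^{-1}$ times the difference of the two sides of
  -- `matrixDeriv_sub_eq`: the untransposed part of $\partial G = C + C^T$ cancels the quadratic
  -- terms.
  have e : -(-((G x)⁻¹ * (C k x + (C k x).transpose) * (G x)⁻¹) * C l x +
        (G x)⁻¹ * matrixDeriv k (C l) x) -
      -(-((G x)⁻¹ * (C l x + (C l x).transpose) * (G x)⁻¹) * C k x +
        (G x)⁻¹ * matrixDeriv l (C k) x) +
      ((G x)⁻¹ * C l x * ((G x)⁻¹ * C k x) - (G x)⁻¹ * C k x * ((G x)⁻¹ * C l x)) =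
      (G x)⁻¹ * ((C k x).transpose * (G x)⁻¹ * C l x - (C l x).transpose * (G x)⁻¹ * C k x) -
      (G x)⁻¹ * (matrixDeriv k (C l) x - matrixDeriv l (C k) x) := by
    noncomm_ring
  have e' := congrFun (congrFun e j) i
  simp only [Matrix.sub_apply, Matrix.add_apply, Matrix.neg_apply] at e' key2 ⊢
  rw [e', key2, sub_self]

end IsLeviCivitaAt

end Connection

/-! ### The cometric on the complement of the coordinate hyperplanes -/

section Torus

variable {n : ℕ}

/-- The constant matrix with entries `1 - δ^{ij}`. -/
noncomputable def offDiagonalOnes (n : ℕ) : Matrix (Fin n) (Fin n) ℂ :=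
  Matrix.of fun i j => 1 - (if i = j then 1 else 0)

theorem det_offDiagonalOnes_ne_zero (hn : 2 ≤ n) : (offDiagonalOnes n).det ≠ 0 := by
  obtain ⟨m, rfl⟩ : ∃ m, n = m + 2 := ⟨n - 2, by omega⟩
  -- With $J$ the all-ones matrix, $J^2 = nJ$ gives $(J-I)^{-1} = J/(n-1) - I$; here $n-1 = m+1$.
  refine (Matrix.isUnit_det_of_right_inverse
    (B := Matrix.of fun i j => ((m : ℂ) + 1)⁻¹ - (if i = j then 1 else 0)) ?_).ne_zero
  have hm : (m : ℂ) + 1 ≠ 0 := by exact_mod_cast m.succ_ne_zero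
  ext i j
  simp only [offDiagonalOnes, Matrix.mul_apply, Matrix.of_apply, Matrix.one_apply, sub_mul, mul_sub,
    Finset.sum_sub_distrib, ite_mul, mul_ite, one_mul, mul_one, zero_mul, mul_zero,
    Finset.sum_ite_eq, Finset.sum_ite_eq', Finset.mem_univ, if_true, Finset.sum_const,
    Finset.card_univ, Fintype.card_fin, nsmul_eq_mul]
  push_cast
  split_ifs <;> field_simp <;> ring

theorem bnCometric_eq (p : Fin n → ℂ) :
    bnCometric n p = Matrix.diagonal (fun i => (p i)⁻¹) * offDiagonalOnes n *
      Matrix.diagonal (fun i => (p i)⁻¹) := by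
  ext i j
  simp only [bnCometric, offDiagonalOnes, Matrix.of_apply, Matrix.mul_diagonal,
    Matrix.diagonal_mul]
  rw [div_eq_mul_inv, mul_inv]
  ring

theorem bnCometric_apply (p : Fin n → ℂ) (i j : Fin n) :
    bnCometric n p i j = offDiagonalOnes n i j * (p i)⁻¹ * (p j)⁻¹ := by
  rw [bnCometric_eq, Matrix.mul_diagonal, Matrix.diagonal_mul]
  ring

theorem offDiagonalOnes_comm (i j : Fin n) : offDiagonalOnes n i j = offDiagonalOnes n j i := by
  simp [offDiagonalOnes, eq_comm]

theorem det_bnCometric_ne_zero (hn : 2 ≤ n) {p : Fin n → ℂ} (hp : p ∈ coordTorus n) :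
    (bnCometric n p).det ≠ 0 := by
  rw [bnCometric_eq, Matrix.det_mul, Matrix.det_mul, Matrix.det_diagonal]
  have h : ∏ i, (p i)⁻¹ ≠ 0 := Finset.prod_ne_zero_iff.2 fun i _ => inv_ne_zero (hp i)
  exact mul_ne_zero (mul_ne_zero h (det_offDiagonalOnes_ne_zero hn)) h

theorem bnCometric_signedPerm {A : Matrix (Fin n) (Fin n) ℂ} (hA : A ∈ signedPermMatrices n)
    (p : Fin n → ℂ) : bnCometric n (A.mulVec p) = A * bnCometric n p * A.transpose := by
  obtain ⟨σ, ε, rfl⟩ := hA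
  have hε : ∀ i, (((ε i : ℤ) : ℂ))⁻¹ = ((ε i : ℤ) : ℂ) := fun i => by
    rcases Int.units_eq_one_or (ε i) with h | h <;> rw [h] <;> norm_num
  ext i j
  have hv : ∀ i, (Matrix.of fun i j => if j = σ i then ((ε i : ℤ) : ℂ) else 0).mulVec p i =
      ε i * p (σ i) := fun i => by
    simp [Matrix.mulVec, dotProduct]
  have ho : offDiagonalOnes n (σ i) (σ j) = offDiagonalOnes n i j := by
    simp [offDiagonalOnes]
  rw [bnCometric_apply, hv, hv]
  simp only [Matrix.mul_apply, Matrix.transpose_apply, Matrix.of_apply, ite_mul, mul_ite, zero_mul,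
    mul_zero, Finset.sum_ite_eq', Finset.mem_univ, if_true, bnCometric_apply, ho, mul_inv, hε]
  ring

/-- The contravariant Christoffel symbols of `bnCometric`, as matrices indexed by the lower
index. -/
noncomputable def bnChristoffel (n : ℕ) (k : Fin n) : CometricField n := fun p =>
  Matrix.of fun i j => -(offDiagonalOnes n i j * (if j = k then 1 else 0) * (p i)⁻¹ * (p j)⁻¹ ^ 2)

theorem hasFDerivAt_coord (i : Fin n) (p : Fin n → ℂ) :
    HasFDerivAt (fun q : Fin n → ℂ => q i) (ContinuousLinearMap.proj (R := ℂ) i) p :=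
  (ContinuousLinearMap.proj (R := ℂ) (φ := fun _ : Fin n => ℂ) i).hasFDerivAt

theorem differentiableAt_coord_inv {p : Fin n → ℂ} {i : Fin n} (hp : p i ≠ 0) :
    DifferentiableAt ℂ (fun q : Fin n → ℂ => (q i)⁻¹) p :=
  (hasFDerivAt_coord i p).differentiableAt.inv hp

theorem coordDeriv_coord_inv {p : Fin n → ℂ} {i : Fin n} (hp : p i ≠ 0) (k : Fin n) :
    coordDeriv k (fun q : Fin n → ℂ => (q i)⁻¹) p = -((if i = k then 1 else 0) * (p i)⁻¹ ^ 2) := by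
  have h : HasFDerivAt (fun q : Fin n → ℂ => (q i)⁻¹) _ p :=
    (hasDerivAt_inv hp).comp_hasFDerivAt p (hasFDerivAt_coord i p)
  rw [coordDeriv, h.fderiv]
  simp [Pi.single_apply, mul_comm]

/-- The $p_a^2$ are flat coordinates, so the only nonzero $\Gamma^j_{sk}$ are $\Gamma^j_{jj} =
1/p_j$; raising an index produces `bnChristoffel`. -/
theorem isLeviCivitaAt_bnCometric {p : Fin n → ℂ} (hp : p ∈ coordTorus n) :
    IsLeviCivitaAt (bnCometric n) (bnChristoffel n) p where
  differentiable i j := by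
    simp only [bnCometric_apply]
    exact ((differentiableAt_coord_inv (hp i)).const_mul _).mul (differentiableAt_coord_inv (hp j))
  symm := by
    ext i j
    rw [Matrix.transpose_apply, bnCometric_apply, bnCometric_apply, offDiagonalOnes_comm]
    ring
  compat k := by
    ext i j
    simp only [matrixDeriv, Matrix.of_apply, bnCometric_apply, Matrix.add_apply,
      Matrix.transpose_apply, bnChristoffel]
    rw [coordDeriv_mul k ((differentiableAt_coord_inv (hp i)).const_mul _)
      (differentiableAt_coord_inv (hp j)), coordDeriv_mul k (differentiableAt_const _)
      (differentiableAt_coord_inv (hp i)), coordDeriv_coord_inv (hp i),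
      coordDeriv_coord_inv (hp j), coordDeriv_const, offDiagonalOnes_comm j i]
    ring
  torsion i j k := by
    simp only [bnCometric_apply, bnChristoffel, Matrix.of_apply, mul_neg, mul_ite, ite_mul,
      mul_one, mul_zero, zero_mul, Finset.sum_neg_distrib, Finset.sum_ite_eq, Finset.mem_univ,
      if_true]
    ring

theorem isFlatConnectionAt_bnCometric {p : Fin n → ℂ} (hp : p ∈ coordTorus n) :
    IsFlatConnectionAt (bnCometric n) (bnChristoffel n) p := by
  have hd : ∀ k i j, DifferentiableAt ℂ (fun q : Fin n → ℂ =>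
      -(offDiagonalOnes n i j * (if j = k then 1 else 0)) * (q i)⁻¹) p :=
    fun k i j => (differentiableAt_coord_inv (hp i)).const_mul _
  have hd2 : ∀ j, DifferentiableAt ℂ (fun q : Fin n → ℂ => (q j)⁻¹ * (q j)⁻¹) p :=
    fun j => (differentiableAt_coord_inv (hp j)).mul (differentiableAt_coord_inv (hp j))
  have hC : ∀ k i j, (fun q => bnChristoffel n k q i j) = fun q =>
      (-(offDiagonalOnes n i j * (if j = k then 1 else 0)) * (q i)⁻¹) * ((q j)⁻¹ * (q j)⁻¹) :=
    fun k i j => by funext q; simp only [bnChristoffel, Matrix.of_apply]; ring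
  have hD : ∀ s k i j, matrixDeriv s (bnChristoffel n k) p i j =
      offDiagonalOnes n i j * (if j = k then 1 else 0) * (p i)⁻¹ * (p j)⁻¹ ^ 2 *
        ((if i = s then 1 else 0) * (p i)⁻¹ + 2 * (if j = s then 1 else 0) * (p j)⁻¹) := by
    intro s k i j
    rw [matrixDeriv, Matrix.of_apply, hC, coordDeriv_mul s (hd k i j) (hd2 j),
      coordDeriv_mul s (differentiableAt_const _) (differentiableAt_coord_inv (hp i)),
      coordDeriv_mul s (differentiableAt_coord_inv (hp j)) (differentiableAt_coord_inv (hp j)),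
      coordDeriv_coord_inv (hp i), coordDeriv_coord_inv (hp j), coordDeriv_const]
    ring
  refine ⟨fun k i j => ?_, fun i j k l => ?_⟩
  · rw [hC]
    exact (hd k i j).mul (hd2 j)
  -- The contributions with coefficient 2, from differentiating $p_k^{-2}$, are symmetric in $s$ and
  -- $l$ and cancel.
  · have h1 : ∀ s, bnCometric n p i s *
        (matrixDeriv s (bnChristoffel n l) p j k - matrixDeriv l (bnChristoffel n s) p j k) =
        (if j = s then bnCometric n p i s * offDiagonalOnes n j k * (if k = l then 1 else 0) *
          (p j)⁻¹ ^ 2 * (p k)⁻¹ ^ 2 else 0) -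
        (if k = s then bnCometric n p i s * offDiagonalOnes n j k * (if j = l then 1 else 0) *
          (p j)⁻¹ ^ 2 * (p k)⁻¹ ^ 2 else 0) := by
      intro s
      rw [hD, hD]
      split_ifs <;> first | (exfalso; simp_all; done) | ring
    rw [Finset.sum_congr rfl fun s _ => h1 s, Finset.sum_sub_distrib, Finset.sum_sub_distrib]
    simp only [Finset.sum_ite_eq, Finset.mem_univ, if_true, bnChristoffel, Matrix.of_apply,
      bnCometric_apply, mul_ite, ite_mul, mul_one, mul_zero, zero_mul, neg_ite,
      neg_zero, mul_neg, neg_mul, neg_neg]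
    split_ifs <;> simp only [Finset.sum_ite_eq, Finset.mem_univ, if_true, Finset.sum_const_zero,
      offDiagonalOnes_comm k j] <;> ring

theorem isOpen_coordTorus (n : ℕ) : IsOpen (coordTorus n) := by
  have : coordTorus n = ⋂ i, {p : Fin n → ℂ | p i ≠ 0} := by ext; simp [coordTorus]
  rw [this]
  exact isOpen_iInter_of_finite fun i => isOpen_ne_fun (continuous_apply i) continuous_const

theorem isFlatMetricOn_bnCometric (hn : 2 ≤ n) :
    IsFlatMetricOn (bnCometric n) (coordTorus n) where
  isOpen := isOpen_coordTorus n
  symm _ hp := (isLeviCivitaAt_bnCometric hp).symm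
  holomorphic i j _ hp :=
    ((isLeviCivitaAt_bnCometric hp).differentiable i j).differentiableWithinAt
  nondegenerate _ hp := subset_closure ⟨hp, det_bnCometric_ne_zero hn hp⟩
  flat _ hp hdet := IsLeviCivitaAt.riemannTensor_eq_zero
    (Filter.eventually_of_mem ((isOpen_coordTorus n).mem_nhds hp) fun _ hy =>
      isLeviCivitaAt_bnCometric hy) (isFlatConnectionAt_bnCometric hp) hdet

end Torus

/-! ### Polynomial metrics -/

section PolynomialCalculus

variable {n : ℕ}

theorem hasFDerivAt_eval (F : MvPolynomial (Fin n) ℂ) (x : Fin n → ℂ) :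
    HasFDerivAt (fun y => eval y F)
      (∑ k, eval x (pderiv k F) • ContinuousLinearMap.proj (R := ℂ) (φ := fun _ => ℂ) k) x := by
  induction F using MvPolynomial.induction_on with
  | C a =>
    simp only [eval_C, pderiv_C, map_zero]
    refine (hasFDerivAt_const (𝕜 := ℂ) a x).congr_fderiv ?_
    ext v
    simp only [_root_.zero_apply, _root_.smul_apply, _root_.sum_apply, zero_smul,
      Finset.sum_const_zero]
  | add p q hp hq =>
    simp only [map_add]
    refine (hp.fun_add hq).congr_fderiv ?_
    ext v
    simp only [_root_.add_apply, _root_.smul_apply, _root_.sum_apply, add_smul,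
      Finset.sum_add_distrib]
  | mul_X p i hp =>
    have h := hp.mul (hasFDerivAt_coord i x)
    simp only [map_mul, eval_X]
    refine h.congr_fderiv ?_
    ext v
    have h1 : ∀ k, eval x (pderiv k (p * X i)) =
        eval x (pderiv k p) * x i + eval x p * (if k = i then 1 else 0) := fun k => by
      rw [pderiv_mul, pderiv_X, Pi.single_apply, map_add, map_mul, map_mul, eval_X]
      congr 2
      split_ifs with h1 h2 h2
      · rw [map_one]
      · exact absurd h1.symm h2
      · exact absurd h2.symm h1
      · rw [map_zero]
    simp only [h1, _root_.add_apply, _root_.smul_apply, _root_.sum_apply,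
      ContinuousLinearMap.proj_apply, smul_eq_mul, add_mul, Finset.sum_add_distrib, mul_ite,
      ite_mul, mul_one, mul_zero, zero_mul, Finset.sum_ite_eq', Finset.mem_univ, if_true,
      Finset.mul_sum]
    rw [add_comm]
    congr 1
    exact Finset.sum_congr rfl fun k _ => by ring

theorem coordDeriv_eval (k : Fin n) (F : MvPolynomial (Fin n) ℂ) (x : Fin n → ℂ) :
    coordDeriv k (fun y => eval y F) x = eval x (pderiv k F) := by
  rw [coordDeriv, (hasFDerivAt_eval F x).fderiv]
  simp [Pi.single_apply]

theorem differentiable_eval (F : MvPolynomial (Fin n) ℂ) :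
    Differentiable ℂ (fun y : Fin n → ℂ => eval y F) :=
  fun x => (hasFDerivAt_eval F x).differentiableAt

theorem pderiv_aeval (f : Fin n → MvPolynomial (Fin n) ℂ) (F : MvPolynomial (Fin n) ℂ)
    (c : Fin n) : pderiv c (aeval f F) = ∑ k, aeval f (pderiv k F) * pderiv c (f k) := by
  induction F using MvPolynomial.induction_on with
  | C a => simp [algebraMap_eq]
  | add p q hp hq => simp only [map_add, hp, hq, add_mul, Finset.sum_add_distrib]
  | mul_X p i hp =>
    have h1 : ∀ k, aeval f (pderiv k (p * X i)) =
        aeval f (pderiv k p) * f i + aeval f p * (if k = i then 1 else 0) := fun k => by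
      rw [pderiv_mul, pderiv_X, Pi.single_apply, map_add, map_mul, map_mul, aeval_X]
      congr 2
      split_ifs with h1 h2 h2
      · rw [map_one]
      · exact absurd h1.symm h2
      · exact absurd h2.symm h1
      · rw [map_zero]
    rw [map_mul, aeval_X, pderiv_mul, hp]
    simp only [h1, add_mul, Finset.sum_add_distrib, mul_ite,
      ite_mul, mul_one, mul_zero, zero_mul, Finset.sum_ite_eq', Finset.mem_univ, if_true,
      Finset.sum_mul]
    refine congrArg (· + _) ?_
    exact Finset.sum_congr rfl fun k _ => by ring

theorem pderiv_comm (i j : Fin n) (F : MvPolynomial (Fin n) ℂ) :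
    pderiv i (pderiv j F) = pderiv j (pderiv i F) := by
  have h : ⁅pderiv (R := ℂ) i, pderiv (R := ℂ) j⁆ =
      (0 : Derivation ℂ (MvPolynomial (Fin n) ℂ) (MvPolynomial (Fin n) ℂ)) := by
    refine MvPolynomial.derivation_ext fun k => ?_
    have h1 : ∀ a b : Fin n, pderiv a (pderiv b (X k : MvPolynomial (Fin n) ℂ)) = 0 := by
      intro a b
      rw [pderiv_X, Pi.single_apply]
      split_ifs
      · exact pderiv_one
      · exact map_zero _
    rw [Derivation.commutator_apply, h1, h1, sub_self, Derivation.zero_apply]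
  have h2 := congrArg (fun D => D F) h
  rw [← sub_eq_zero, ← Derivation.commutator_apply]
  exact h2

theorem pderiv_pderiv_eq_zero {m : Fin n} {F : MvPolynomial (Fin n) ℂ} (h : F.degreeOf m ≤ 1) :
    pderiv m (pderiv m F) = 0 := by
  conv_lhs => rw [F.as_sum]
  simp only [map_sum]
  refine Finset.sum_eq_zero fun s hs => ?_
  have hs1 : s m ≤ 1 := (monomial_le_degreeOf m hs).trans h
  rw [pderiv_monomial, pderiv_monomial]
  have : (s - Finsupp.single m 1 : Fin n →₀ ℕ) m = 0 := by
    simp only [Finsupp.tsub_apply, Finsupp.single_eq_same]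
    omega
  simp [this]

/-- Translation of the polynomial ring along the `m`-th coordinate. -/
noncomputable def shiftHom (m : Fin n) (t : ℂ) :
    MvPolynomial (Fin n) ℂ →ₐ[ℂ] MvPolynomial (Fin n) ℂ :=
  aeval fun i => X i + C (Pi.single (M := fun _ => ℂ) m t i)

theorem pderiv_shiftHom (m k : Fin n) (t : ℂ) (F : MvPolynomial (Fin n) ℂ) :
    pderiv k (shiftHom m t F) = shiftHom m t (pderiv k F) := by
  rw [shiftHom, pderiv_aeval, Finset.sum_eq_single k]
  · simp
  · intro b _ hb
    simp [pderiv_X_of_ne hb]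
  · simp

theorem eval_shiftHom (m : Fin n) (t : ℂ) (x : Fin n → ℂ) (F : MvPolynomial (Fin n) ℂ) :
    eval x (shiftHom m t F) = eval (x + Pi.single m t) F := by
  induction F using MvPolynomial.induction_on with
  | C a => simp [shiftHom, algebraMap_eq]
  | add p q hp hq => simp [hp, hq]
  | mul_X p i hp =>
    rw [map_mul, map_mul, map_mul, hp, eval_X]
    simp [shiftHom]

/-- The Taylor expansion along $x_m$ stops at first order. This is why translating the metric by $t$
along $u_{n-1}$ adds $t\eta$. -/
theorem eval_add_single {m : Fin n} {F : MvPolynomial (Fin n) ℂ} (h : F.degreeOf m ≤ 1)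
    (x : Fin n → ℂ) (t : ℂ) :
    eval (x + Pi.single m t) F = eval x F + t * eval x (pderiv m F) := by
  conv_lhs => rw [F.as_sum]
  conv_rhs => rw [F.as_sum]
  simp only [map_sum, Finset.mul_sum]
  rw [← Finset.sum_add_distrib]
  refine Finset.sum_congr rfl fun s hs => ?_
  have hs1 : s m ≤ 1 := (monomial_le_degreeOf m hs).trans h
  rw [pderiv_monomial, eval_monomial, eval_monomial, eval_monomial,
    Finsupp.prod_fintype _ _ (by simp), Finsupp.prod_fintype _ _ (by simp),
    Finsupp.prod_fintype _ _ (by simp)]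
  rw [← Finset.mul_prod_erase _ _ (Finset.mem_univ m), ← Finset.mul_prod_erase _ _
    (Finset.mem_univ m), ← Finset.mul_prod_erase _ _ (Finset.mem_univ m)]
  have e1 : ∏ i ∈ Finset.univ.erase m, (x + Pi.single m t : Fin n → ℂ) i ^ s i =
      ∏ i ∈ Finset.univ.erase m, x i ^ s i :=
    Finset.prod_congr rfl fun i hi => by simp [Finset.ne_of_mem_erase hi]
  have e2 : ∏ i ∈ Finset.univ.erase m, x i ^ (s - Finsupp.single m 1 : Fin n →₀ ℕ) i =
      ∏ i ∈ Finset.univ.erase m, x i ^ s i :=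
    Finset.prod_congr rfl fun i hi => by simp [Finset.ne_of_mem_erase hi]
  rw [e1, e2]
  interval_cases hsm : s m
  · simp [hsm]
  · simp [hsm]
    ring

end PolynomialCalculus

/-! ### Polynomial metrics affine in one coordinate: translation, derivative, density -/

section PolynomialMetrics

variable {n : ℕ}

/-- The polynomials `Q i j k` satisfy the equations which characterise the contravariant
Christoffel symbols `Γ^{ij}_k` of the metric `P`. -/
structure IsPolyLeviCivita (P : Matrix (Fin n) (Fin n) (MvPolynomial (Fin n) ℂ))
    (Q : Fin n → Fin n → Fin n → MvPolynomial (Fin n) ℂ) : Prop where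
  symm : ∀ i j, P i j = P j i
  compat : ∀ i j k, pderiv k (P i j) = Q i j k + Q j i k
  torsion : ∀ i j k, ∑ s, P i s * Q j k s = ∑ s, P j s * Q i k s

/-- The connection with contravariant Christoffel symbols `Q` on the metric `P` is flat. -/
def IsPolyFlat (P : Matrix (Fin n) (Fin n) (MvPolynomial (Fin n) ℂ))
    (Q : Fin n → Fin n → Fin n → MvPolynomial (Fin n) ℂ) : Prop :=
  ∀ i j k l, ∑ s, P i s * (pderiv s (Q j k l) - pderiv l (Q j k s)) =
    ∑ s, (Q i j s * Q s k l - Q i k s * Q s j l)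

/-- The polynomials `Q i j k` as fields of matrices indexed by the lower index. -/
noncomputable def polyConnection (Q : Fin n → Fin n → Fin n → MvPolynomial (Fin n) ℂ)
    (k : Fin n) : CometricField n := fun x => Matrix.of fun i j => eval x (Q i j k)

variable {P : Matrix (Fin n) (Fin n) (MvPolynomial (Fin n) ℂ)}
  {Q : Fin n → Fin n → Fin n → MvPolynomial (Fin n) ℂ}

namespace IsPolyLeviCivita

theorem isLeviCivitaAt (h : IsPolyLeviCivita P Q) (x : Fin n → ℂ) :
    IsLeviCivitaAt (polyField P) (polyConnection Q) x where
  differentiable i j := differentiable_eval (P i j) x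
  symm := by
    ext i j
    simp [polyField, h.symm i j]
  compat k := by
    ext i j
    have := coordDeriv_eval k (P i j) x
    rw [h.compat, map_add] at this
    exact this
  torsion i j k := by
    have := congrArg (eval x) (h.torsion i j k)
    simp only [map_sum, map_mul] at this
    exact this

theorem contraChristoffel_eq (h : IsPolyLeviCivita P Q) {x : Fin n → ℂ}
    (hdet : (polyField P x).det ≠ 0) (i j k : Fin n) :
    contraChristoffel (polyField P) i j k x = eval x (Q i j k) :=
  (h.isLeviCivitaAt x).contraChristoffel_eq hdet i j k

theorem riemannTensor_eq_zero (h : IsPolyLeviCivita P Q) (hQ : IsPolyFlat P Q) {x : Fin n → ℂ}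
    (hdet : (polyField P x).det ≠ 0) (i j k l : Fin n) :
    riemannTensor (polyField P) i j k l x = 0 := by
  refine IsLeviCivitaAt.riemannTensor_eq_zero (C := polyConnection Q)
    (Filter.Eventually.of_forall h.isLeviCivitaAt) ⟨fun k i j => ?_, fun i j k l => ?_⟩ hdet
      i j k l
  · exact differentiable_eval (Q i j k) x
  · have := congrArg (eval x) (hQ i j k l)
    simp only [map_sum, map_mul, map_sub] at this
    simp only [matrixDeriv, Matrix.of_apply, polyConnection, coordDeriv_eval]
    exact this

theorem isMetricOn (h : IsPolyLeviCivita P Q)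
    (hd : Dense {x | (polyField P x).det ≠ 0}) : IsMetricOn (polyField P) Set.univ where
  isOpen := isOpen_univ
  symm x _ := (h.isLeviCivitaAt x).symm
  holomorphic i j := (differentiable_eval (P i j)).differentiableOn
  nondegenerate x _ := by simpa using hd x

theorem isFlatMetricOn (h : IsPolyLeviCivita P Q) (hQ : IsPolyFlat P Q)
    (hd : Dense {x | (polyField P x).det ≠ 0}) : IsFlatMetricOn (polyField P) Set.univ where
  toIsMetricOn := h.isMetricOn hd
  flat _ _ hdet := h.riemannTensor_eq_zero hQ hdet

theorem shift (h : IsPolyLeviCivita P Q) (m : Fin n) (t : ℂ) :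
    IsPolyLeviCivita (P.map (shiftHom m t)) (fun i j k => shiftHom m t (Q i j k)) where
  symm i j := by simp [h.symm i j]
  compat i j k := by simp [pderiv_shiftHom, h.compat]
  torsion i j k := by
    have := congrArg (shiftHom m t) (h.torsion i j k)
    simpa using this

/-- The equations for $\eta$ are the top-order part of those for $g$. Compatibility is linear, so
one derivative suffices; torsion is bilinear in quantities affine in $x_m$, so two derivatives give
twice the torsion equation of the derivatives. -/
theorem pderiv {m : Fin n} (h : IsPolyLeviCivita P Q) (hP : ∀ i j, (P i j).degreeOf m ≤ 1)
    (hQ : ∀ i j k, (Q i j k).degreeOf m ≤ 1) :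
    IsPolyLeviCivita (P.map (pderiv m)) (fun i j k => pderiv m (Q i j k)) where
  symm i j := by simp [h.symm i j]
  compat i j k := by
    rw [Matrix.map_apply, pderiv_comm k m, h.compat, map_add]
  torsion i j k := by
    have key : ∀ i j, MvPolynomial.pderiv m (MvPolynomial.pderiv m (∑ s, P i s * Q j k s)) =
        2 * ∑ s, MvPolynomial.pderiv m (P i s) * MvPolynomial.pderiv m (Q j k s) := by
      intro i j
      simp only [map_sum, pderiv_mul, map_add, pderiv_pderiv_eq_zero (hP _ _),
        pderiv_pderiv_eq_zero (hQ _ _ _), Finset.mul_sum]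
      exact Finset.sum_congr rfl fun s _ => by ring
    have h2 := h.torsion i j k
    apply_fun fun F => MvPolynomial.pderiv m (MvPolynomial.pderiv m F) at h2
    rw [key, key] at h2
    exact mul_left_cancel₀ two_ne_zero h2

end IsPolyLeviCivita

theorem IsPolyFlat.shift (h : IsPolyFlat P Q) (m : Fin n) (t : ℂ) :
    IsPolyFlat (P.map (shiftHom m t)) (fun i j k => shiftHom m t (Q i j k)) := by
  intro i j k l
  have := congrArg (shiftHom m t) (h i j k l)
  simpa [pderiv_shiftHom] using this

theorem polyField_add_single {m : Fin n} (hP : ∀ i j, (P i j).degreeOf m ≤ 1)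
    (x : Fin n → ℂ) (t : ℂ) :
    polyField P (x + Pi.single m t) = polyField P x + t • polyField (P.map (pderiv m)) x := by
  ext i j
  simp [polyField, eval_add_single (hP i j)]

theorem polyField_shift {m : Fin n} (hP : ∀ i j, (P i j).degreeOf m ≤ 1) (t : ℂ) :
    polyField (P.map (shiftHom m t)) =
      fun x => polyField P x + t • polyField (P.map (pderiv m)) x := by
  funext x
  rw [← polyField_add_single hP]
  ext i j
  simp [polyField, eval_shiftHom]

/-- On the line through $x$ in direction $m$ the determinant is a polynomial in one variable whose
coefficient in degree $n$ is $\det\eta(x) \ne 0$, so its zeros there are isolated. -/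
theorem dense_det_ne_zero {m : Fin n} (hP : ∀ i j, (P i j).degreeOf m ≤ 1)
    (hdet : ∀ x, (polyField (P.map (pderiv m)) x).det ≠ 0) (t : ℂ) :
    Dense {x | (polyField P x + t • polyField (P.map (pderiv m)) x).det ≠ 0} := by
  intro x
  set A := polyField (P.map (pderiv m)) x with hA
  set p : Polynomial ℂ := ((Polynomial.X : Polynomial ℂ) • A.map Polynomial.C +
    (polyField P x).map Polynomial.C).det with hp
  have hp0 : p ≠ 0 := by
    intro h0
    have := Polynomial.coeff_det_X_add_C_card A (polyField P x)
    rw [← hp, h0, Polynomial.coeff_zero] at this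
    exact hdet x this.symm
  have heval : ∀ s, p.eval s = (polyField P x + s • A).det := by
    intro s
    rw [hp, ← Polynomial.coe_evalRingHom, RingHom.map_det]
    congr 1
    ext i j
    simp only [RingHom.mapMatrix_apply, Matrix.map_apply, Matrix.add_apply, Matrix.smul_apply,
      smul_eq_mul, Polynomial.coe_evalRingHom, Polynomial.eval_add, Polynomial.eval_mul,
      Polynomial.eval_X, Polynomial.eval_C]
    exact add_comm _ _
  -- At $x + (s-t)e_m$ the field $P + t\,\partial_m P$ takes the value $P(x) + sA$, so $s \to t$
  -- approaches $x$ through values of `p`.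
  have hlim : Filter.Tendsto (fun s : ℂ => x + Pi.single m (s - t)) (nhdsWithin t {t}ᶜ)
      (nhds x) := by
    have hc : Continuous (fun s : ℂ => x + Pi.single m (s - t)) := by
      refine continuous_const.add ?_
      exact (continuous_single m).comp (continuous_id.sub continuous_const)
    have := (hc.tendsto t).mono_left (nhdsWithin_le_nhds (s := {t}ᶜ))
    simpa using this
  have hne : ∀ᶠ s in nhdsWithin t {t}ᶜ, p.eval s ≠ 0 := by
    have hfin : {s | p.IsRoot s}.Finite := Polynomial.finite_setOfPred_isRoot hp0
    -- `t` itself may be a root; the remaining roots form a finite, hence closed, set that misses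
    -- it.
    have : ∀ᶠ s in nhdsWithin t {t}ᶜ, s ∉ {s | p.IsRoot s} \ {t} := by
      refine nhdsWithin_le_nhds ?_
      exact (hfin.subset Set.sdiff_subset).isClosed.isOpen_compl.mem_nhds (by simp)
    filter_upwards [this, self_mem_nhdsWithin] with s hs hst h0
    exact hs ⟨h0, hst⟩
  refine mem_closure_of_tendsto hlim ?_
  filter_upwards [hne] with s hs
  rw [heval, hA, ← polyField_add_single hP] at hs
  rw [← polyField_add_single hP, add_assoc, ← Pi.single_add, sub_add_cancel]
  exact hs

end PolynomialMetrics

/-! ### Derivatives of elementary symmetric polynomials -/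

section Esymm

variable {n : ℕ}

theorem esymm_insert_recursion (a : Fin n) (k : ℕ) :
    esymm (Fin n) ℂ (k + 1) =
      ∑ t ∈ (Finset.univ.erase a).powersetCard (k + 1), ∏ i ∈ t, (X i : MvPolynomial (Fin n) ℂ) +
      X a * ∑ t ∈ (Finset.univ.erase a).powersetCard k, ∏ i ∈ t, X i := by
  have ha : a ∉ (Finset.univ.erase a : Finset (Fin n)) := Finset.notMem_erase _ _
  rw [esymm, ← Finset.insert_erase (Finset.mem_univ a), Finset.powersetCard_succ_insert ha,
    Finset.sum_union, Finset.erase_insert ha]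
  · congr 1
    rw [Finset.sum_image, Finset.mul_sum]
    · refine Finset.sum_congr rfl fun t ht => Finset.prod_insert fun hat => ha ?_
      exact (Finset.mem_powersetCard.1 ht).1 hat
    · intro s hs t ht hst
      have h : ∀ {u}, u ∈ (Finset.univ.erase a).powersetCard k → a ∉ u := fun hu hau =>
        ha ((Finset.mem_powersetCard.1 hu).1 hau)
      rw [← Finset.erase_insert (h hs), hst, Finset.erase_insert (h ht)]
  · rw [Finset.disjoint_left]
    intro t ht ht'
    obtain ⟨u, -, rfl⟩ := Finset.mem_image.1 ht'
    exact ha ((Finset.mem_powersetCard.1 ht).1 (Finset.mem_insert_self a u))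

theorem pderiv_sum_powersetCard_erase (a : Fin n) (k : ℕ) :
    pderiv a (∑ t ∈ (Finset.univ.erase a).powersetCard k,
      ∏ i ∈ t, (X i : MvPolynomial (Fin n) ℂ)) = 0 := by
  rw [map_sum]
  have h : ∀ t : Finset (Fin n), a ∉ t →
      pderiv a (∏ i ∈ t, (X i : MvPolynomial (Fin n) ℂ)) = 0 := by
    intro t
    induction t using Finset.cons_induction with
    | empty => simp
    | cons b t hb ih =>
      intro hat
      rw [Finset.mem_cons, not_or] at hat
      rw [Finset.prod_cons, pderiv_mul, pderiv_X_of_ne (Ne.symm hat.1), ih hat.2]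
      ring
  exact Finset.sum_eq_zero fun t ht => h t fun hat =>
    Finset.notMem_erase _ _ ((Finset.mem_powersetCard.1 ht).1 hat)

theorem pderiv_esymm_succ_eq (a : Fin n) (k : ℕ) :
    pderiv a (esymm (Fin n) ℂ (k + 1)) =
      ∑ t ∈ (Finset.univ.erase a).powersetCard k, ∏ i ∈ t, X i := by
  rw [esymm_insert_recursion a, map_add, pderiv_mul, pderiv_sum_powersetCard_erase,
    pderiv_sum_powersetCard_erase, pderiv_X_self]
  ring

theorem pderiv_esymm_zero (a : Fin n) : pderiv a (esymm (Fin n) ℂ 0) = 0 := by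
  rw [esymm_zero, pderiv_one]

/-- Both $\partial_a e_{k+1}$ and the part of $e_k$ free of $x_a$ are the $k$-th elementary
symmetric polynomial in the other variables. -/
theorem pderiv_esymm_succ (a : Fin n) (k : ℕ) :
    pderiv a (esymm (Fin n) ℂ (k + 1)) =
      esymm (Fin n) ℂ k - X a * pderiv a (esymm (Fin n) ℂ k) := by
  rw [pderiv_esymm_succ_eq]
  cases k with
  | zero => simp
  | succ k =>
    rw [pderiv_esymm_succ_eq, esymm_insert_recursion a]
    ring

theorem sum_X_mul_pderiv_esymm (k : ℕ) :
    ∑ a, X a * pderiv a (esymm (Fin n) ℂ k) = (k : MvPolynomial (Fin n) ℂ) * esymm (Fin n) ℂ k := by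
  have h : (esymm (Fin n) ℂ k).IsHomogeneous k := by
    refine IsHomogeneous.sum _ _ _ fun t ht => ?_
    have := IsHomogeneous.prod t (fun i => (X i : MvPolynomial (Fin n) ℂ)) (fun _ => 1)
      fun i _ => isHomogeneous_X ℂ i
    simpa [(Finset.mem_powersetCard.1 ht).2] using this
  rw [h.sum_X_mul_pderiv, nsmul_eq_mul]

theorem sum_pderiv_esymm_succ (k : ℕ) :
    ∑ a, pderiv a (esymm (Fin n) ℂ (k + 1)) =
      ((n : MvPolynomial (Fin n) ℂ) - k) * esymm (Fin n) ℂ k := by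
  simp only [pderiv_esymm_succ, Finset.sum_sub_distrib, sum_X_mul_pderiv_esymm, Finset.sum_const,
    Finset.card_univ, Fintype.card_fin, nsmul_eq_mul]
  ring

/-- Using the recursion on both factors to eliminate $x_a$ gives $\partial_a e_{i+2}\,\partial_a
e_{j+1} = \partial_a e_{i+1}\,\partial_a e_{j+2} + e_{i+1}\,\partial_a e_{j+1} - e_{j+1}\,\partial_a
e_{i+1}$. Induction lowers the first index down to $\partial_a e_1 = 1$. The subtraction `i - 1 - m`
is never truncated, as $m < i$. -/
theorem sum_pderiv_esymm_mul_succ (i j : ℕ) :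
    ∑ a, pderiv a (esymm (Fin n) ℂ (i + 1)) * pderiv a (esymm (Fin n) ℂ (j + 1)) =
      ((n : MvPolynomial (Fin n) ℂ) - j) * (esymm (Fin n) ℂ i * esymm (Fin n) ℂ j) -
      ∑ m ∈ Finset.range i, ((j : MvPolynomial (Fin n) ℂ) - i + 2 * m + 2) *
        (esymm (Fin n) ℂ (i - 1 - m) * esymm (Fin n) ℂ (j + 1 + m)) := by
  induction i generalizing j with
  | zero =>
    have h : ∀ a : Fin n, pderiv a (esymm (Fin n) ℂ (0 + 1)) = 1 := fun a => by
      rw [pderiv_esymm_succ, esymm_zero, pderiv_one, mul_zero, sub_zero]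
    simp only [h, one_mul, sum_pderiv_esymm_succ, esymm_zero, Finset.range_zero, Finset.sum_empty,
      sub_zero]
  | succ i ih =>
    have h1 : ∀ a : Fin n, pderiv a (esymm (Fin n) ℂ (i + 1 + 1)) *
        pderiv a (esymm (Fin n) ℂ (j + 1)) =
        pderiv a (esymm (Fin n) ℂ (i + 1)) * pderiv a (esymm (Fin n) ℂ (j + 1 + 1)) +
        esymm (Fin n) ℂ (i + 1) * pderiv a (esymm (Fin n) ℂ (j + 1)) -
        esymm (Fin n) ℂ (j + 1) * pderiv a (esymm (Fin n) ℂ (i + 1)) := fun a => by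
      rw [pderiv_esymm_succ a (i + 1), pderiv_esymm_succ a (j + 1)]
      ring
    simp only [h1, Finset.sum_sub_distrib, Finset.sum_add_distrib, ← Finset.mul_sum,
      sum_pderiv_esymm_succ, ih (j + 1)]
    rw [Finset.sum_range_succ']
    have h2 : ∀ m ∈ Finset.range i, ((j : MvPolynomial (Fin n) ℂ) - (i + 1 : ℕ) +
        2 * (m + 1 : ℕ) + 2) *
        (esymm (Fin n) ℂ (i + 1 - 1 - (m + 1)) * esymm (Fin n) ℂ (j + 1 + (m + 1))) =
        (((j + 1 : ℕ) : MvPolynomial (Fin n) ℂ) - i + 2 * m + 2) *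
        (esymm (Fin n) ℂ (i - 1 - m) * esymm (Fin n) ℂ (j + 1 + 1 + m)) := fun m _ => by
      rw [show i + 1 - 1 - (m + 1) = i - 1 - m by omega,
        show j + 1 + (m + 1) = j + 1 + 1 + m by ring]
      push_cast
      ring
    rw [Finset.sum_congr rfl h2]
    push_cast
    simp only [Nat.sub_zero, add_zero, mul_zero]
    ring

/-- The constant cometric `4 (1 - δ^{ab})` in the coordinates `x_a = p_a ^ 2`. -/
noncomputable def flatCometric (F G : Fin n → MvPolynomial (Fin n) ℂ) : MvPolynomial (Fin n) ℂ :=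
  4 * ((∑ a, F a) * (∑ a, G a) - ∑ a, F a * G a)

theorem flatCometric_comm (F G : Fin n → MvPolynomial (Fin n) ℂ) :
    flatCometric F G = flatCometric G F := by
  simp only [flatCometric, mul_comm (F _)]
  ring

theorem flatCometric_add_right (F G H : Fin n → MvPolynomial (Fin n) ℂ) :
    flatCometric F (G + H) = flatCometric F G + flatCometric F H := by
  simp only [flatCometric, Pi.add_apply, mul_add, Finset.sum_add_distrib]
  ring

theorem flatCometric_smul_right (F G : Fin n → MvPolynomial (Fin n) ℂ)
    (c : MvPolynomial (Fin n) ℂ) :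
    flatCometric F (c • G) = c * flatCometric F G := by
  simp only [flatCometric, Pi.smul_apply, smul_eq_mul, mul_left_comm _ c, ← Finset.mul_sum]
  ring

theorem flatCometric_sum_right {ι : Type*} (s : Finset ι) (F : Fin n → MvPolynomial (Fin n) ℂ)
    (G : ι → Fin n → MvPolynomial (Fin n) ℂ) :
    flatCometric F (∑ i ∈ s, G i) = ∑ i ∈ s, flatCometric F (G i) := by
  induction s using Finset.cons_induction with
  | empty => simp [flatCometric]
  | cons a s ha ih => rw [Finset.sum_cons, Finset.sum_cons, flatCometric_add_right, ih]

theorem pderiv_flatCometric (c : Fin n) (F G : Fin n → MvPolynomial (Fin n) ℂ) :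
    pderiv c (flatCometric F G) = flatCometric (fun a => pderiv c (F a)) G +
      flatCometric F (fun a => pderiv c (G a)) := by
  have h4 : pderiv c (4 : MvPolynomial (Fin n) ℂ) = 0 := by
    rw [show (4 : MvPolynomial (Fin n) ℂ) = C 4 from (map_ofNat C 4).symm, pderiv_C]
  simp only [flatCometric, pderiv_mul, h4, map_sub, map_sum, Finset.sum_add_distrib]
  ring

/-- The differential of the `k`-th elementary symmetric polynomial. -/
noncomputable def esymmGrad (n k : ℕ) (a : Fin n) : MvPolynomial (Fin n) ℂ :=
  pderiv a (esymm (Fin n) ℂ k)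

/-- The algebra homomorphism which substitutes the elementary symmetric polynomials. -/
noncomputable def esymmHom (n : ℕ) : MvPolynomial (Fin n) ℂ →ₐ[ℂ] MvPolynomial (Fin n) ℂ :=
  aeval fun i : Fin n => esymm (Fin n) ℂ (i + 1)

/-- Algebraic independence of the elementary symmetric polynomials. -/
theorem esymmHom_injective (n : ℕ) : Function.Injective (esymmHom n) := by
  intro F G h
  refine MvPolynomial.esymmAlgHom_fin_injective ℂ (le_refl n) ?_
  apply Subtype.ext
  rw [esymmAlgHom_apply, esymmAlgHom_apply]
  exact h

theorem pderiv_esymmHom (F : MvPolynomial (Fin n) ℂ) (c : Fin n) :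
    pderiv c (esymmHom n F) = ∑ k, esymmHom n (pderiv k F) * esymmGrad n (k + 1) c :=
  pderiv_aeval _ F c

/-- The coordinate `u_k`, extended by `u_0 = 1` and `u_k = 0` for `k > n`. -/
noncomputable def extX (n k : ℕ) : MvPolynomial (Fin n) ℂ :=
  if k = 0 then 1 else if h : k - 1 < n then X ⟨k - 1, h⟩ else 0

theorem esymmHom_extX (n k : ℕ) : esymmHom n (extX n k) = esymm (Fin n) ℂ k := by
  rw [extX]
  split_ifs with h0 h
  · rw [h0, esymm_zero, map_one]
  · rw [esymmHom, aeval_X]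
    congr 1
    exact Nat.sub_add_cancel (Nat.pos_of_ne_zero h0)
  · rw [map_zero, esymm, Finset.powersetCard_eq_empty.2, Finset.sum_empty]
    rw [Finset.card_univ, Fintype.card_fin]
    omega

theorem degreeOf_extX_le (n k : ℕ) (m : Fin n) :
    (extX n k).degreeOf m ≤ if k = m + 1 then 1 else 0 := by
  rw [extX]
  split_ifs with h0 h1 h1 h1 h1
  all_goals try simp
  · rw [degreeOf_X]
    split_ifs <;> omega
  · rw [degreeOf_X, if_neg]
    intro he
    rw [Fin.ext_iff] at he
    simp only at he
    omega

theorem pderiv_extX (n k : ℕ) (m : Fin n) :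
    pderiv m (extX n k) = if k = m + 1 then 1 else 0 := by
  have hm := m.isLt
  by_cases h : k = m + 1
  · subst h
    simp [extX]
  · rw [if_neg h, extX]
    split_ifs with h0 h1
    · exact pderiv_one
    · rw [pderiv_X_of_ne]
      intro he
      rw [Fin.ext_iff] at he
      simp only at he
      omega
    · exact map_zero _

end Esymm

/-! ### The metric and its connection in the basic invariants -/

section GradComb

variable {n : ℕ}

/-- The 1-forms `w` which are combinations of the differentials `de_1, …, de_n` whose coefficients
are polynomials in the elementary symmetric polynomials, of degree at most one in each of them. -/
def IsGradComb (w : Fin n → MvPolynomial (Fin n) ℂ) : Prop :=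
  ∃ q : Fin n → MvPolynomial (Fin n) ℂ, (∀ k m, (q k).degreeOf m ≤ 1) ∧
    ∀ c, w c = ∑ k, esymmHom n (q k) * esymmGrad n (k + 1) c

theorem IsGradComb.zero : IsGradComb (0 : Fin n → MvPolynomial (Fin n) ℂ) :=
  ⟨0, fun k m => by simp, fun c => by simp⟩

theorem IsGradComb.add {v w : Fin n → MvPolynomial (Fin n) ℂ} (hv : IsGradComb v)
    (hw : IsGradComb w) : IsGradComb (v + w) := by
  obtain ⟨q, hq, hv⟩ := hv
  obtain ⟨r, hr, hw⟩ := hw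
  refine ⟨q + r, fun k m => (degreeOf_add_le m _ _).trans (max_le (hq k m) (hr k m)), fun c => ?_⟩
  simp only [Pi.add_apply, hv, hw, map_add, add_mul, Finset.sum_add_distrib]

theorem IsGradComb.smul {w : Fin n → MvPolynomial (Fin n) ℂ} (hw : IsGradComb w) (a : ℂ) :
    IsGradComb fun c => C a * w c := by
  obtain ⟨r, hr, hw⟩ := hw
  refine ⟨fun k => C a * r k, fun k m => (degreeOf_C_mul_le _ _ _).trans (hr k m), fun c => ?_⟩
  have hC : esymmHom n (C a) = C a := (esymmHom n).commutes a
  simp only [hw, map_mul, hC, Finset.mul_sum, mul_assoc]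

theorem IsGradComb.sub {v w : Fin n → MvPolynomial (Fin n) ℂ} (hv : IsGradComb v)
    (hw : IsGradComb w) : IsGradComb (v - w) := by
  convert hv.add (hw.smul (-1)) using 1
  funext c
  simp [sub_eq_add_neg]

/-- The building block of all later combinations: one factor $e_a$ as coefficient, hence degree at
most one, which sums preserve. If $b$ is not in $1,\dots,n$, then $de_b = 0$. -/
theorem isGradComb_esymm_mul (a b : ℕ) :
    IsGradComb fun c : Fin n => esymm (Fin n) ℂ a * esymmGrad n b c := by
  by_cases hb : ∃ k : Fin n, b = k + 1
  · obtain ⟨k, rfl⟩ := hb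
    refine ⟨Pi.single k (extX n a), fun l m => ?_, fun c => ?_⟩
    · rw [Pi.single_apply]
      split_ifs
      · exact (degreeOf_extX_le n a m).trans (by split_ifs <;> simp)
      · simp
    · rw [Finset.sum_eq_single k]
      · rw [Pi.single_eq_same, esymmHom_extX]
      · intro l _ hl
        rw [Pi.single_eq_of_ne hl, map_zero, zero_mul]
      · simp
  · convert IsGradComb.zero using 1
    funext c
    have h : pderiv c (esymm (Fin n) ℂ b) = 0 := by
      rw [← esymmHom_extX, extX]
      split_ifs with h0 h1
      · rw [map_one, pderiv_one]
      · exact absurd ⟨⟨b - 1, h1⟩, by simp only; omega⟩ hb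
      · rw [map_zero, map_zero]
    rw [esymmGrad, h, mul_zero, Pi.zero_apply]

theorem sum_esymmGrad (k : ℕ) :
    ∃ s : ℂ, ∑ a, esymmGrad n k a = C s * esymm (Fin n) ℂ (k - 1) := by
  cases k with
  | zero => exact ⟨0, by simp [esymmGrad]⟩
  | succ k =>
    refine ⟨n - k, ?_⟩
    simp only [esymmGrad, sum_pderiv_esymm_succ]
    simp

/-- The same exchange of indices as for $\langle de_i, de_j\rangle$, now componentwise; it ends at
$de_0 = 0$. -/
theorem isGradComb_esymmGrad_mul (i j : ℕ) :
    IsGradComb fun c : Fin n => esymmGrad n i c * esymmGrad n j c := by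
  induction i generalizing j with
  | zero =>
    convert IsGradComb.zero using 1
    funext c
    rw [esymmGrad, pderiv_esymm_zero, zero_mul, Pi.zero_apply]
  | succ i ih =>
    convert ((ih (j + 1)).add (isGradComb_esymm_mul i j)).sub (isGradComb_esymm_mul j i) using 1
    funext c
    simp only [Pi.add_apply, Pi.sub_apply, esymmGrad, pderiv_esymm_succ]
    ring

/-- The exchange applied to a gradient and a Hessian. Since $\partial_c x_a = \delta_{ac}$ it leaves
the extra term $\partial_c e_i\,\partial_c e_j$, covered by `isGradComb_esymmGrad_mul`. Every other
correction is a scalar times $e_r\,de_s$, so products of two $e$'s never enter the coefficients. -/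
theorem isGradComb_sum_esymmGrad_mul_pderiv (i j : ℕ) :
    IsGradComb fun c : Fin n => ∑ a, esymmGrad n i a * pderiv c (esymmGrad n j a) := by
  induction i generalizing j with
  | zero =>
    convert IsGradComb.zero using 1
    funext c
    simp [esymmGrad]
  | succ i ih =>
    obtain ⟨s, hs⟩ := sum_esymmGrad (n := n) i
    obtain ⟨t, ht⟩ := sum_esymmGrad (n := n) j
    convert (((ih (j + 1)).add ((isGradComb_esymm_mul i (j - 1)).smul t)).sub
      ((isGradComb_esymm_mul (i - 1) j).smul s)).add (isGradComb_esymmGrad_mul i j) using 1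
    funext c
    have hX : ∀ a : Fin n, esymmGrad n i a * pderiv c (X a * esymmGrad n j a) =
        (if a = c then esymmGrad n i c * esymmGrad n j c else 0) +
          X a * esymmGrad n i a * pderiv c (esymmGrad n j a) := fun a => by
      rw [pderiv_mul]
      split_ifs with h
      · subst h
        rw [pderiv_X_self]
        ring
      · rw [pderiv_X_of_ne h]
        ring
    have h1 : ∀ a : Fin n, esymmGrad n (i + 1) a * pderiv c (esymmGrad n j a) =
        esymmGrad n i a * pderiv c (esymmGrad n (j + 1) a) +
        esymm (Fin n) ℂ i * pderiv c (esymmGrad n j a) - esymmGrad n i a * esymmGrad n j c +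
        (if a = c then esymmGrad n i c * esymmGrad n j c else 0) := fun a => by
      have e1 : esymmGrad n (j + 1) a = esymm (Fin n) ℂ j - X a * esymmGrad n j a :=
        pderiv_esymm_succ a j
      have e2 : esymmGrad n (i + 1) a = esymm (Fin n) ℂ i - X a * esymmGrad n i a :=
        pderiv_esymm_succ a i
      have e3 : pderiv c (esymm (Fin n) ℂ j) = esymmGrad n j c := rfl
      rw [e1, e2, map_sub, mul_sub, hX, e3]
      ring
    have h2 : ∑ a, pderiv c (esymmGrad n j a) = C t * esymmGrad n (j - 1) c := by
      rw [← map_sum, ht, pderiv_C_mul, esymmGrad]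
    simp only [h1, Pi.add_apply, Pi.sub_apply, Finset.sum_add_distrib, Finset.sum_sub_distrib,
      ← Finset.mul_sum, ← Finset.sum_mul, h2, hs, Finset.sum_ite_eq', Finset.mem_univ, if_true]
    ring

theorem isGradComb_flatCometric (i j : ℕ) :
    IsGradComb fun c : Fin n =>
      flatCometric (esymmGrad n i) fun a => pderiv c (esymmGrad n j a) := by
  obtain ⟨s, hs⟩ := sum_esymmGrad (n := n) i
  obtain ⟨t, ht⟩ := sum_esymmGrad (n := n) j
  convert (((isGradComb_esymm_mul (i - 1) (j - 1)).smul (s * t)).sub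
    (isGradComb_sum_esymmGrad_mul_pderiv i j)).smul 4 using 1
  funext c
  have h2 : ∑ a, pderiv c (esymmGrad n j a) = C t * esymmGrad n (j - 1) c := by
    rw [← map_sum, ht, pderiv_C_mul, esymmGrad]
  rw [flatCometric, hs, h2, show (4 : MvPolynomial (Fin n) ℂ) = C 4 from (map_ofNat C 4).symm,
    C_mul, Pi.sub_apply]
  ring

end GradComb

/-! ### Transfer of the connection equations from $x$ to the invariants -/

section Connection

variable {n : ℕ}

theorem flatCometric_eq_sum (F W : Fin n → MvPolynomial (Fin n) ℂ) :
    flatCometric F W = ∑ a, W a * flatCometric F (Pi.single a 1) := by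
  conv_lhs => rw [pi_eq_sum_univ' W]
  rw [flatCometric_sum_right]
  exact Finset.sum_congr rfl fun a _ => by rw [flatCometric_smul_right]

theorem esymmGrad_symm (k : ℕ) (a b : Fin n) :
    pderiv a (esymmGrad n k b) = pderiv b (esymmGrad n k a) :=
  pderiv_comm _ _ _

variable {P : Matrix (Fin n) (Fin n) (MvPolynomial (Fin n) ℂ)}
  {Q : Fin n → Fin n → Fin n → MvPolynomial (Fin n) ℂ}

/-- Pairing a relation among the $de_k$ with each $de_i$ says that the Gram matrix, which is $P$
evaluated at $e(x)$, kills the coefficient vector; its determinant is nonzero by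
`esymmHom_injective`. -/
theorem esymmGrad_linearIndependent (hdet : P.det ≠ 0)
    (hP : ∀ i j : Fin n, esymmHom n (P i j) =
      flatCometric (esymmGrad n (i + 1)) (esymmGrad n (j + 1)))
    {a b : Fin n → MvPolynomial (Fin n) ℂ}
    (h : ∀ c, ∑ k, a k * esymmGrad n (k + 1) c = ∑ k, b k * esymmGrad n (k + 1) c) : a = b := by
  have hd : (P.map (esymmHom n)).det ≠ 0 := by
    rw [← AlgHom.mapMatrix_apply, ← AlgHom.map_det]
    exact fun h0 => hdet (esymmHom_injective n (h0.trans (map_zero _).symm))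
  have hv : ∑ k : Fin n, (a - b) k • esymmGrad n (k + 1) = 0 := by
    funext c
    simp only [Finset.sum_apply, Pi.smul_apply, Pi.sub_apply, smul_eq_mul, sub_mul,
      Finset.sum_sub_distrib, h, sub_self, Pi.zero_apply]
  refine sub_eq_zero.1 (Matrix.eq_zero_of_mulVec_eq_zero hd ?_)
  funext i
  have h2 := congrArg (flatCometric (esymmGrad n (i + 1))) hv
  rw [flatCometric_sum_right] at h2
  simp only [flatCometric_smul_right, ← hP] at h2
  rw [Matrix.mulVec, dotProduct, Pi.zero_apply]
  refine Eq.trans (Finset.sum_congr rfl fun k _ => ?_) (h2.trans (by simp [flatCometric]))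
  exact mul_comm _ _

/-- Compatibility is the product rule for a constant form. For torsion, both sides are the Hessian
of $e_{k+1}$ evaluated on the gradient vectors of $e_{i+1}$ and $e_{j+1}$, which is symmetric in $i$
and $j$. -/
theorem isPolyLeviCivita_of_esymm (hdet : P.det ≠ 0)
    (hP : ∀ i j : Fin n, esymmHom n (P i j) =
      flatCometric (esymmGrad n (i + 1)) (esymmGrad n (j + 1)))
    (hQ : ∀ (i j : Fin n) c, ∑ k, esymmHom n (Q i j k) * esymmGrad n (k + 1) c =
      flatCometric (esymmGrad n (i + 1)) fun a => pderiv c (esymmGrad n (j + 1) a)) :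
    IsPolyLeviCivita P Q where
  symm i j := esymmHom_injective n (by rw [hP, hP, flatCometric_comm])
  compat i j := by
    refine congrFun ((esymmHom_injective n).comp_left (esymmGrad_linearIndependent hdet hP ?_))
    intro c
    have h := pderiv_esymmHom (P i j) c
    rw [hP, pderiv_flatCometric, flatCometric_comm, ← hQ j i, ← hQ i j] at h
    simp only [Function.comp_apply, map_add, add_mul, Finset.sum_add_distrib]
    rw [← h, add_comm]
  torsion i j k := by
    refine esymmHom_injective n ?_
    have key : ∀ i j : Fin n, esymmHom n (∑ s, P i s * Q j k s) =
        ∑ b, ∑ a, pderiv b (esymmGrad n (k + 1) a) *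
          flatCometric (esymmGrad n (j + 1)) (Pi.single a 1) *
          flatCometric (esymmGrad n (i + 1)) (Pi.single b 1) := by
      intro i j
      have h1 : (∑ s : Fin n, esymmHom n (Q j k s) • esymmGrad n (s + 1)) = fun c =>
          flatCometric (esymmGrad n (j + 1)) fun a => pderiv c (esymmGrad n (k + 1) a) := by
        funext c
        simp only [Finset.sum_apply, Pi.smul_apply, smul_eq_mul, hQ]
      have h2 := congrArg (flatCometric (esymmGrad n (i + 1))) h1
      rw [flatCometric_sum_right] at h2
      simp only [flatCometric_smul_right, ← hP] at h2
      rw [map_sum]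
      simp only [map_mul, mul_comm (esymmHom n (P i _)), h2]
      rw [flatCometric_eq_sum]
      refine Finset.sum_congr rfl fun b _ => ?_
      rw [flatCometric_eq_sum (esymmGrad n (j + 1)), Finset.sum_mul]
    rw [key, key, Finset.sum_comm]
    refine Finset.sum_congr rfl fun a _ => Finset.sum_congr rfl fun b _ => ?_
    rw [esymmGrad_symm]
    ring

/-- After pairing with the $de_{l+1}$, both sides become the contraction over $b$ of the gradient
vector of $e_{i+1}$ with $\langle\partial_b de_{j+1},\partial_c de_{k+1}\rangle - \langle\partial_b
de_{k+1},\partial_c de_{j+1}\rangle$. -/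
theorem isPolyFlat_of_esymm (hdet : P.det ≠ 0)
    (hP : ∀ i j : Fin n, esymmHom n (P i j) =
      flatCometric (esymmGrad n (i + 1)) (esymmGrad n (j + 1)))
    (hQ : ∀ (i j : Fin n) c, ∑ k, esymmHom n (Q i j k) * esymmGrad n (k + 1) c =
      flatCometric (esymmGrad n (i + 1)) fun a => pderiv c (esymmGrad n (j + 1) a)) :
    IsPolyFlat P Q := by
  intro i j k
  refine congrFun ((esymmHom_injective n).comp_left (esymmGrad_linearIndependent hdet hP ?_))
  intro c
  -- `f` is the gradient vector of $e_{i+1}$ (its differential with index raised), and `D b k` is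
  -- row $b$ of the Hessian of $e_{k+1}$.
  let f : Fin n → MvPolynomial (Fin n) ℂ := fun b =>
    flatCometric (esymmGrad n (i + 1)) (Pi.single b 1)
  let D : Fin n → Fin n → Fin n → MvPolynomial (Fin n) ℂ := fun b k a =>
    pderiv b (esymmGrad n (k + 1) a)
  have hf : ∀ W, flatCometric (esymmGrad n (i + 1)) W = ∑ b, W b * f b :=
    fun W => flatCometric_eq_sum _ W
  have hQ' : ∀ (i j : Fin n) c, ∑ k, esymmHom n (Q i j k) * esymmGrad n (k + 1) c =
      flatCometric (esymmGrad n (i + 1)) (D c j) := hQ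
  have hright : ∀ j k : Fin n, ∑ l : Fin n, (∑ s, esymmHom n (Q i j s) * esymmHom n (Q s k l)) *
      esymmGrad n (l + 1) c = ∑ b, f b * flatCometric (D b j) (D c k) := by
    intro j k
    have h1 : (∑ s : Fin n, esymmHom n (Q i j s) • esymmGrad n (s + 1)) = ∑ b, f b • D b j := by
      funext b
      simp only [Finset.sum_apply, Pi.smul_apply, smul_eq_mul]
      rw [hQ', hf]
      refine Finset.sum_congr rfl fun a _ => ?_
      rw [mul_comm]
      exact congrArg (f a * ·) (esymmGrad_symm _ _ _)
    have h2 := congrArg (flatCometric (D c k)) h1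
    rw [flatCometric_sum_right, flatCometric_sum_right] at h2
    simp only [flatCometric_smul_right] at h2
    simp only [flatCometric_comm (D c k), ← hQ' _ k] at h2
    simp only [Finset.sum_mul]
    rw [Finset.sum_comm, ← h2]
    refine Finset.sum_congr rfl fun s _ => ?_
    rw [Finset.mul_sum]
    exact Finset.sum_congr rfl fun l _ => by ring
  -- Differentiate the defining equation of $\Gamma^{jk}$ and antisymmetrise in $b, c$: third
  -- derivatives of $e_{k+1}$ and Hessians of the $e_{l+1}$ are symmetric and drop out.
  have hleft : ∀ b, ∑ s : Fin n, esymmGrad n (s + 1) b *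
      (∑ l, esymmHom n (pderiv s (Q j k l)) * esymmGrad n (l + 1) c -
        ∑ l, esymmHom n (pderiv l (Q j k s)) * esymmGrad n (l + 1) c) =
      flatCometric (D b j) (D c k) - flatCometric (D b k) (D c j) := by
    intro b
    have hA : ∀ b c, ∑ l : Fin n, pderiv b (esymmHom n (Q j k l)) * esymmGrad n (l + 1) c =
        flatCometric (D b j) (D c k) + flatCometric (esymmGrad n (j + 1))
          (fun a => pderiv b (D c k a)) - ∑ l : Fin n, esymmHom n (Q j k l) * D b l c := by
      intro b c
      have h := congrArg (pderiv b) (hQ' j k c)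
      rw [pderiv_flatCometric, map_sum] at h
      simp only [pderiv_mul, Finset.sum_add_distrib] at h
      exact eq_sub_of_add_eq h
    have h1 : ∑ s : Fin n, esymmGrad n (s + 1) b *
        ∑ l, esymmHom n (pderiv s (Q j k l)) * esymmGrad n (l + 1) c =
        ∑ l : Fin n, pderiv b (esymmHom n (Q j k l)) * esymmGrad n (l + 1) c := by
      simp only [pderiv_esymmHom, Finset.mul_sum, Finset.sum_mul]
      rw [Finset.sum_comm]
      exact Finset.sum_congr rfl fun l _ => Finset.sum_congr rfl fun s _ => by ring
    have h2 : ∑ s : Fin n, esymmGrad n (s + 1) b *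
        ∑ l, esymmHom n (pderiv l (Q j k s)) * esymmGrad n (l + 1) c =
        ∑ s : Fin n, pderiv c (esymmHom n (Q j k s)) * esymmGrad n (s + 1) b := by
      refine Finset.sum_congr rfl fun s _ => ?_
      rw [pderiv_esymmHom, mul_comm]
    have h3 : (fun a => pderiv b (D c k a)) = fun a => pderiv c (D b k a) :=
      funext fun a => pderiv_comm _ _ _
    have h4 : ∀ l : Fin n, D b l c = D c l b := fun l => esymmGrad_symm _ _ _
    simp only [mul_sub, Finset.sum_sub_distrib]
    rw [h1, h2, hA, hA, h3, flatCometric_comm (D b k)]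
    simp only [h4]
    ring
  simp only [Function.comp_apply, map_sum, map_sub, map_mul, Finset.sum_sub_distrib, sub_mul]
  rw [hright, hright, ← Finset.sum_sub_distrib]
  have hsum : ∑ l : Fin n, (∑ s, esymmHom n (P i s) *
      (esymmHom n (pderiv s (Q j k l)) - esymmHom n (pderiv l (Q j k s)))) *
        esymmGrad n (l + 1) c = ∑ b, f b * ∑ s : Fin n, esymmGrad n (s + 1) b *
      (∑ l, esymmHom n (pderiv s (Q j k l)) * esymmGrad n (l + 1) c -
        ∑ l, esymmHom n (pderiv l (Q j k s)) * esymmGrad n (l + 1) c) := by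
    have h1 : ∀ b, f b * ∑ s : Fin n, esymmGrad n (s + 1) b *
        (∑ l, esymmHom n (pderiv s (Q j k l)) * esymmGrad n (l + 1) c -
          ∑ l, esymmHom n (pderiv l (Q j k s)) * esymmGrad n (l + 1) c) =
        ∑ s : Fin n, esymmGrad n (s + 1) b * f b *
          ∑ l, (esymmHom n (pderiv s (Q j k l)) - esymmHom n (pderiv l (Q j k s))) *
            esymmGrad n (l + 1) c := fun b => by
      rw [Finset.mul_sum]
      refine Finset.sum_congr rfl fun s _ => ?_
      rw [← Finset.sum_sub_distrib]
      simp only [← sub_mul]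
      ring
    rw [Finset.sum_congr rfl fun b _ => h1 b, Finset.sum_comm]
    simp only [← Finset.sum_mul, ← hf, ← hP]
    simp only [Finset.mul_sum, Finset.sum_mul]
    rw [Finset.sum_comm]
    exact Finset.sum_congr rfl fun l _ => Finset.sum_congr rfl fun s _ => by ring
  simp only [← map_sub, ← Finset.sum_sub_distrib, ← map_mul, ← sub_mul] at hsum ⊢
  rw [hsum]
  refine Finset.sum_congr rfl fun b _ => ?_
  rw [← mul_sub, ← hleft]
  simp only [map_sub, sub_mul, Finset.sum_sub_distrib]

end Connection

/-! ### Explicit metric in the invariants, its degree, and the determinant of its derivative -/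

section InvariantMetric

variable {n : ℕ}

/-- The components `g^{ij}(u)` of the cometric as polynomials in the basic invariants. -/
noncomputable def invariantMetric (n : ℕ) : Matrix (Fin n) (Fin n) (MvPolynomial (Fin n) ℂ) :=
  Matrix.of fun i j => C (4 * (((n : ℂ) - 1 - i) * (n - j))) * (extX n i * extX n j) +
    ∑ m ∈ Finset.range i, C (4 * ((j : ℂ) - i + 2 * m + 2)) *
      (extX n (i - 1 - m) * extX n (j + 1 + m))

/-- The products of sums contribute $(n-i)(n-j)e_ie_j$ and `sum_pderiv_esymm_mul_succ` removes
$(n-j)e_ie_j$; hence the factor $n-1-i$. -/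
theorem esymmHom_invariantMetric (i j : Fin n) :
    esymmHom n (invariantMetric n i j) =
      flatCometric (esymmGrad n (i + 1)) (esymmGrad n (j + 1)) := by
  rw [flatCometric]
  simp only [esymmGrad, sum_pderiv_esymm_mul_succ, sum_pderiv_esymm_succ, invariantMetric,
    Matrix.of_apply, map_add, map_sum, map_mul, esymmHom_extX, map_ofNat, map_sub, map_one,
    map_natCast, mul_assoc (4 : MvPolynomial (Fin n) ℂ), ← Finset.mul_sum]
  ring

theorem degreeOf_C_mul_extX_mul_le (a : ℂ) (k l : ℕ) (m : Fin n)
    (h : a = 0 ∨ k ≠ m + 1 ∨ l ≠ m + 1) :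
    (C a * (extX n k * extX n l)).degreeOf m ≤ 1 := by
  by_cases ha : a = 0
  · simp [ha]
  · refine (degreeOf_C_mul_le _ _ _).trans ((degreeOf_mul_le _ _ _).trans ?_)
    have h1 := degreeOf_extX_le n k m
    have h2 := degreeOf_extX_le n l m
    split_ifs at h1 h2 <;> first | omega | (exfalso; tauto)

/-- A square of $u_{n-1}$ needs both factors to have index $n-1$. In the leading product this forces
$i = n-1$, where the coefficient $n-1-i$ is zero; in the sum the first index is at most $n-2$. -/
theorem degreeOf_invariantMetric_le (hn : 2 ≤ n) (i j : Fin n) :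
    (invariantMetric n i j).degreeOf (penultimate n hn) ≤ 1 := by
  have hi := i.isLt
  refine (degreeOf_add_le _ _ _).trans (max_le ?_ ?_)
  · refine degreeOf_C_mul_extX_mul_le _ _ _ _ ?_
    by_cases h : (i : ℕ) = penultimate n hn + 1
    · left
      have h' : (n : ℂ) - 1 - (i : ℕ) = 0 := by
        rw [h, penultimate, show n - 2 + 1 = n - 1 by omega, Nat.cast_sub (by omega)]
        simp
      rw [h', zero_mul, mul_zero]
    · exact Or.inr (Or.inl h)
  · refine (degreeOf_sum_le _ _ _).trans (Finset.sup_le fun m _ => ?_)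
    refine degreeOf_C_mul_extX_mul_le _ _ _ _ (Or.inr (Or.inl ?_))
    rw [penultimate]
    simp only
    omega

theorem pderiv_C_mul_extX_mul (a : ℂ) (k l : ℕ) (m : Fin n) :
    pderiv m (C a * (extX n k * extX n l)) =
      C a * ((if k = m + 1 then 1 else 0) * extX n l +
        extX n k * (if l = m + 1 then 1 else 0)) := by
  rw [pderiv_C_mul, pderiv_mul, pderiv_extX, pderiv_extX]

/-- Each product in the $(i,j)$ entry has indices adding up to $i+j < n-1$, so $u_{n-1}$ does not
occur. -/
theorem derivPenultimate_invariantMetric_of_lt (hn : 2 ≤ n) {i j : Fin n}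
    (h : (i : ℕ) + j + 1 < n) : derivPenultimate hn (invariantMetric n) i j = 0 := by
  rw [derivPenultimate, Matrix.map_apply, invariantMetric, Matrix.of_apply, map_add, map_sum]
  simp only [pderiv_C_mul_extX_mul, penultimate]
  rw [if_neg (by omega), if_neg (by omega), Finset.sum_eq_zero]
  · ring
  · intro m hm
    rw [Finset.mem_range] at hm
    rw [if_neg (by omega), if_neg (by omega)]
    ring

/-- Now the indices add up to $n-1$, so $u_{n-1}$ occurs only as $u_0u_{n-1}$ with $u_0 = 1$. It
comes from the leading product if $i = 0$, and otherwise from $m = i-1$ with coefficient $4(i+j) =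
4(n-1)$. -/
theorem derivPenultimate_invariantMetric_of_eq (hn : 2 ≤ n) {i j : Fin n}
    (h : (i : ℕ) + j + 1 = n) :
    derivPenultimate hn (invariantMetric n) i j = C (4 * ((n : ℂ) - 1)) := by
  have hn' : (n : ℂ) = i + j + 1 := by exact_mod_cast h.symm
  have hx : extX n 0 = 1 := if_pos rfl
  rw [derivPenultimate, Matrix.map_apply, invariantMetric, Matrix.of_apply, map_add, map_sum]
  simp only [pderiv_C_mul_extX_mul, penultimate]
  rcases Nat.eq_zero_or_pos (i : ℕ) with hi | hi
  · rw [hi, Finset.range_zero, Finset.sum_empty, if_neg (by omega), if_pos (by omega), hx, hn', hi]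
    simp
  · rw [Finset.sum_eq_single ((i : ℕ) - 1)]
    · rw [if_neg (by omega : ¬ (i : ℕ) - 1 - (i - 1) = n - 2 + 1), if_pos
        (by omega : (j : ℕ) + 1 + (i - 1) = n - 2 + 1), Nat.sub_self, hx, hn',
        Nat.cast_sub (by omega)]
      -- For $i > 0$ the leading product contains $u_{n-1}$ only if $j = 0$, and then its
      -- coefficient vanishes.
      have h1 : C (4 * (((i : ℕ) + (j : ℕ) + 1 : ℂ) - 1 - (i : ℕ)) * ((i + j + 1) - j)) *
          ((if (i : ℕ) = n - 2 + 1 then 1 else 0) * extX n j +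
            extX n i * (if (j : ℕ) = n - 2 + 1 then 1 else 0)) = 0 := by
        rw [if_neg (by omega : ¬ (j : ℕ) = n - 2 + 1)]
        by_cases hj : (j : ℕ) = 0
        · rw [hj]
          simp
        · rw [if_neg (by omega)]
          ring
      rw [← mul_assoc, h1]
      simp only [zero_mul, mul_one, zero_add]
      congr 1
      push_cast
      ring
    · intro m hm hm'
      rw [Finset.mem_range] at hm
      rw [if_neg (by omega), if_neg (by omega)]
      ring
    · intro hm
      exact absurd (Finset.mem_range.2 (by omega)) hm

theorem det_derivPenultimate_invariantMetric (hn : 2 ≤ n) :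
    ∃ c : ℂ, c ≠ 0 ∧ (derivPenultimate hn (invariantMetric n)).det = C c := by
  set M := derivPenultimate hn (invariantMetric n) with hM
  -- Reversing the columns turns the antidiagonal into the diagonal of a lower triangular matrix and
  -- changes the determinant only by a sign.
  have h1 : (M.submatrix id Fin.revPerm).det = C ((4 * ((n : ℂ) - 1)) ^ n) := by
    rw [Matrix.det_of_isLowerTriangular]
    · rw [Finset.prod_congr rfl fun i _ => ?_, Finset.prod_const, Finset.card_univ,
        Fintype.card_fin, ← C_pow]
      rw [Matrix.submatrix_apply, hM]
      refine derivPenultimate_invariantMetric_of_eq hn ?_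
      simp only [id, Fin.revPerm_apply, Fin.val_rev]
      omega
    · intro i j hij
      have hij' : i < j := hij
      rw [Matrix.submatrix_apply, hM]
      refine derivPenultimate_invariantMetric_of_lt hn ?_
      simp only [id, Fin.revPerm_apply, Fin.val_rev]
      have := Fin.lt_def.1 hij'
      omega
  rw [Matrix.det_permute'] at h1
  have hc : (4 * ((n : ℂ) - 1)) ^ n ≠ 0 := by
    refine pow_ne_zero _ (mul_ne_zero (by norm_num) (sub_ne_zero.2 ?_))
    exact_mod_cast (by omega : n ≠ 1)
  rcases Int.units_eq_one_or (Equiv.Perm.sign (Fin.revPerm : Equiv.Perm (Fin n))) with h | h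
  · refine ⟨_, hc, ?_⟩
    rw [h] at h1
    simpa using h1
  · refine ⟨_, neg_ne_zero.2 hc, ?_⟩
    rw [h] at h1
    rw [map_neg, ← h1]
    simp

theorem eval_aeval_sq (p : Fin n → ℂ) (F : MvPolynomial (Fin n) ℂ) :
    eval p (aeval (fun k : Fin n => (X k : MvPolynomial (Fin n) ℂ) ^ 2) F) =
      eval (fun a => p a ^ 2) F := by
  induction F using MvPolynomial.induction_on with
  | C a => rw [aeval_C, algebraMap_eq, eval_C, eval_C]
  | add F G hF hG => rw [map_add, map_add, map_add, hF, hG]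
  | mul_X F i hF => rw [map_mul, map_mul, map_mul, hF, aeval_X, map_pow, eval_X, eval_X]

theorem eval_invariantMap (p : Fin n → ℂ) (F : MvPolynomial (Fin n) ℂ) :
    eval (invariantMap n p) F = eval (fun a => p a ^ 2) (esymmHom n F) := by
  induction F using MvPolynomial.induction_on with
  | C a => rw [eval_C, show esymmHom n (C a) = C a from (esymmHom n).commutes a, eval_C]
  | add p q hp hq => rw [map_add, map_add, map_add, hp, hq]
  | mul_X F i hF =>
    rw [map_mul, map_mul, map_mul, hF, eval_X, esymmHom, aeval_X, invariantMap, basicInvariant,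
      eval_aeval_sq]

theorem eval_pderiv_basicInvariant (p : Fin n → ℂ) (i k : Fin n) :
    eval p (pderiv k (basicInvariant n i)) =
      2 * p k * eval (fun a => p a ^ 2) (esymmGrad n (i + 1) k) := by
  rw [basicInvariant, pderiv_aeval, Finset.sum_eq_single k]
  · rw [map_mul, eval_aeval_sq, pderiv_pow, pderiv_X_self, esymmGrad]
    simp only [map_mul, map_pow, eval_X, map_one, map_natCast]
    push_cast
    ring
  · intro j _ hj
    rw [pderiv_pow, pderiv_X_of_ne hj, mul_zero, mul_zero]
  · simp

/-- The chain-rule factors $2p_k$ and $2p_l$ cancel the denominator $p_kp_l$, leaving the constant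
$4(1-\delta^{kl})$. -/
theorem bnCometricInInvariants_eq {p : Fin n → ℂ} (hp : p ∈ coordTorus n) (i j : Fin n) :
    bnCometricInInvariants n p i j = eval (fun a => p a ^ 2)
      (flatCometric (esymmGrad n (i + 1)) (esymmGrad n (j + 1))) := by
  have h : ∀ k l, bnCometric n p k l * eval p (pderiv k (basicInvariant n i)) *
      eval p (pderiv l (basicInvariant n j)) =
      4 * (eval (fun a => p a ^ 2) (esymmGrad n (i + 1) k) *
        eval (fun a => p a ^ 2) (esymmGrad n (j + 1) l) -
        (if k = l then eval (fun a => p a ^ 2) (esymmGrad n (i + 1) k) *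
          eval (fun a => p a ^ 2) (esymmGrad n (j + 1) k) else 0)) := by
    intro k l
    have hk := hp k
    have hl := hp l
    rw [eval_pderiv_basicInvariant, eval_pderiv_basicInvariant, bnCometric, Matrix.of_apply]
    split_ifs with hkl
    · subst hkl
      ring
    · field_simp
      ring
  simp only [bnCometricInInvariants, h, flatCometric, ← Finset.mul_sum, Finset.sum_sub_distrib,
    Finset.sum_ite_eq, Finset.mem_univ, if_true, map_mul, map_sub, map_sum, map_ofNat,
    ← Finset.sum_mul]

end InvariantMetric

theorem mainTheorem2 (n : ℕ) (hn : 2 ≤ n) :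
    (∀ A ∈ signedPermMatrices n, ∀ p ∈ coordTorus n,
      bnCometric n (A.mulVec p) = A * bnCometric n p * A.transpose) ∧
    (∀ p ∈ coordTorus n, (bnCometric n p).det ≠ 0) ∧
    IsFlatMetricOn (bnCometric n) (coordTorus n) ∧
    ∃ P : Matrix (Fin n) (Fin n) (MvPolynomial (Fin n) ℂ),
      (∀ p ∈ coordTorus n, ∀ i j,
        MvPolynomial.eval (invariantMap n p) (P i j) = bnCometricInInvariants n p i j) ∧
      (∀ i j, (P i j).degreeOf (penultimate n hn) ≤ 1) ∧
      IsFlatMetricOn (polyField P) Set.univ ∧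
      (∃ Q : Fin n → Fin n → Fin n → MvPolynomial (Fin n) ℂ,
        (∀ i j k, (Q i j k).degreeOf (penultimate n hn) ≤ 1) ∧
        ∀ x, (polyField P x).det ≠ 0 → ∀ i j k,
          contraChristoffel (polyField P) i j k x = MvPolynomial.eval x (Q i j k)) ∧
      (∃ c : ℂ, c ≠ 0 ∧ (derivPenultimate hn P).det = MvPolynomial.C c) ∧
      IsFlatPencilOn (polyField P) (polyField (derivPenultimate hn P)) Set.univ := by

  obtain ⟨c, hc0, hc⟩ := det_derivPenultimate_invariantMetric hn
  set P := invariantMetric n with hPdef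
  have hdeg : ∀ i j, (P i j).degreeOf (penultimate n hn) ≤ 1 := degreeOf_invariantMetric_le hn
  have hη : ∀ x, (polyField (derivPenultimate hn P) x).det ≠ 0 := by
    intro x
    have h : (polyField (derivPenultimate hn P) x).det = c := by
      rw [polyField, ← RingHom.mapMatrix_apply, ← RingHom.map_det, hc, eval_C]
    rw [h]
    exact hc0
  have hdense := dense_det_ne_zero hdeg hη
  have hdense0 : Dense {x | (polyField P x).det ≠ 0} := by simpa using hdense 0
  have hP0 : P.det ≠ 0 := by
    obtain ⟨x, hx⟩ := hdense0.nonempty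
    intro h0
    refine hx ?_
    rw [polyField, ← RingHom.mapMatrix_apply, ← RingHom.map_det, h0, map_zero]
  have hP : ∀ i j : Fin n, esymmHom n (P i j) =
      flatCometric (esymmGrad n (i + 1)) (esymmGrad n (j + 1)) := esymmHom_invariantMetric
  choose Q hQdeg hQ using fun i j : Fin n =>
    isGradComb_flatCometric (n := n) ((i : ℕ) + 1) ((j : ℕ) + 1)
  have hLC : IsPolyLeviCivita P Q :=
    isPolyLeviCivita_of_esymm hP0 hP fun i j c => (hQ i j c).symm
  have hflat : IsPolyFlat P Q := isPolyFlat_of_esymm hP0 hP fun i j c => (hQ i j c).symm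
  have hQ1 : ∀ i j k, (Q i j k).degreeOf (penultimate n hn) ≤ 1 := fun i j k => hQdeg i j k _
  have hLCη := hLC.pderiv hdeg hQ1
  refine ⟨fun A hA p _ => bnCometric_signedPerm hA p, fun p hp => det_bnCometric_ne_zero hn hp,
    isFlatMetricOn_bnCometric hn, P, fun p hp i j => ?_, hdeg, hLC.isFlatMetricOn hflat hdense0,
    ⟨Q, hQ1, fun x hx i j k => hLC.contraChristoffel_eq hx i j k⟩, ⟨c, hc0, hc⟩, ?_⟩
  · rw [eval_invariantMap, hP, bnCometricInInvariants_eq hp]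
  · refine ⟨hLC.isMetricOn hdense0, hLCη.isMetricOn ?_, fun t => ?_,
      fun i j k x => eval x (Q i j k),
      fun i j k x => eval x (pderiv (penultimate n hn) (Q i j k)),
      fun x _ hx i j k => hLC.contraChristoffel_eq hx i j k,
      fun x _ hx i j k => hLCη.contraChristoffel_eq hx i j k, fun t x _ hx i j k => ?_⟩
    · exact fun x => subset_closure (hη x)
    -- `polyField_shift` identifies the translated metric with $g + t\eta$.
    · have h := (hLC.shift (penultimate n hn) t).isFlatMetricOn
        (hflat.shift (penultimate n hn) t) (by rw [polyField_shift hdeg]; exact hdense t)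
      rw [polyField_shift hdeg] at h
      exact h
    · have h := (hLC.shift (penultimate n hn) t).contraChristoffel_eq (x := x)
        (by rw [polyField_shift hdeg]; exact hx) i j k
      rw [polyField_shift hdeg, eval_shiftHom, eval_add_single (hQ1 i j k)] at h
      exact h
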